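/- Let $\tilde{\mathcal U}$ be the associative $\mathbb Q$-algebra generated by $c$, $h_r$, $x_r^{\pm}$, $X_{2r+1}^{\pm}$ ($r\in\mathbb Z$) with relations: $c$ is central and $$[h_r,h_s]=\delta_{r+s,0}\,2r(2+(-1)^{r-1})c,\qquad [h_r,x_s^{\pm}]=\pm2(2+(-1)^{r-1})x_{r+s}^{\pm},$$ $$[h_r,X_s^{\pm}]=\pm4X_{r+s}^{\pm}\ (r\text{ even}),\qquad [h_r,X_s^{\pm}]=0\ (r\text{ odd}),$$ $$[x_r^{\pm},x_s^{\pm}]=0\ (r+s\text{ even}),\qquad [x_r^{\pm},x_s^{\pm}]=\pm(-1)^sX_{r+s}^{\pm}\ (r+s\text{ odd}),\qquad [x_r^{\pm},X_s^{\pm}]=[X_r^{\pm},X_s^{\pm}]=0,$$ $$[x_r^+,x_s^-]=h_{r+s}+\delta_{r+s,0}rc,\qquad [x_r^{\pm},X_s^{\mp}]=\pm(-1)^r4x_{r+s}^{\mp},\qquad [X_r^+,X_s^-]=8h_{r+s}+4\delta_{r+s,0}rc$$ (indices of the $X$'s are odd). This is the enveloping algebra of the affine Kac–Moody algebra of type $A_2^{(2)}$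 (without derivation) in its Drinfeld presentation, with Chevalley generators $e_1=x_0^+$, $f_1=x_0^-$, $e_0=\frac14X_1^-$, $f_0=\frac14X_{-1}^+$. Put $y_{2r+1}^{\pm}=\frac14X_{2r+1}^{\pm}$, $\mathfrak h_r=\frac12h_r$, $\tilde c=\frac14c$, and $\varepsilon_r=-1$ if $4\mid r$, $\varepsilon_r=1$ otherwise. For elements of a $\mathbb Q$-algebra let $a^{(k)}=a^k/k!$ and $\binom ak=a(a-1)\cdots(a-k+1)/k!$. For a family $(x_i)$ of commuting elements with $\mathbb Z$-span $M$ let $\mathbb Z^{(div)}[x_i]$ and $\mathbb Z^{(bin)}[x_i]$ be the (unital) $\mathbb Z$-subalgebras generated by $\{a^{(k)}\mid a\in M,k\in\mathbb N\}$ and $\{\binom ak\mid a\in M,k\in\mathbb N\}$. For commuting elements $p_r$ ($r>0$) let $\mathbb Z^{(sym)}[p_r\mid r>0]$ be the $\mathbb Z$-subalgebra generated by the $\hat p_k$ ($k>0$), where $\sum_{k\ge0}\hat p_ku^k=\exp\big(\sum_{r>0}(-1)^{r-1}\frac{p_r}ru^r\big)$. Let $\tilde{\mathcal U}_{\mathbb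 Z}$, respectively $\tilde{\mathcal U}_{\mathbb Z}^{\pm}$, be the $\mathbb Z$-subalgebra of $\tilde{\mathcal U}$ generated by all $(x_r^+)^{(k)}$ and $(x_r^-)^{(k)}$, respectively by all $(x_r^{\pm})^{(k)}$ (for one sign); let $\tilde{\mathcal U}_{\mathbb Z}^0$ be generated by $\mathbb Z^{(sym)}[\varepsilon_rh_{-r}\mid r>0]$, $\mathbb Z^{(bin)}[h_0,c]$ and $\mathbb Z^{(sym)}[\varepsilon_rh_r\mid r>0]$. Let $\tilde{\mathcal U}_{\mathbb Z,M}$ (Mitzman's integral form) be the $\mathbb Z$-subalgebra generated by all $e_i^{(k)},f_i^{(k)}$ ($i=0,1$, $k\in\mathbb N$), and let $\tilde{\mathcal U}_{\mathbb Z,M}^{\pm}$, $\tilde{\mathcal U}_{\mathbb Z,M}^0$ be its components, namely the products of $\mathbb Z$-submodules $$\tilde{\mathcal U}_{\mathbb Z,M}^{\pm}=\mathbb Z^{(div)}[x_{2r}^{\pm}\mid r\in\mathbb Z]\cdot\mathbb Z^{(div)}[y_{2r+1}^{\pm}\mid r\in\mathbb Z]\cdot\mathbb Z^{(div)}[x_{2r+1}^{\pm}\mid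 r\in\mathbb Z],$$ $$\tilde{\mathcal U}_{\mathbb Z,M}^0=\mathbb Z^{(sym)}[\mathfrak h_{-r}\mid r>0]\cdot\mathbb Z^{(bin)}[2\mathfrak h_0,\tilde c-\mathfrak h_0]\cdot\mathbb Z^{(sym)}[\mathfrak h_r\mid r>0].$$ Then $\tilde{\mathcal U}_{\mathbb Z}\subsetneq\tilde{\mathcal U}_{\mathbb Z,M}$. More precisely, for each choice of sign: $$\mathbb Z^{(div)}[X_{2r+1}^{\pm}\mid r\in\mathbb Z]\subsetneq\mathbb Z^{(div)}[y_{2r+1}^{\pm}\mid r\in\mathbb Z],\qquad \tilde{\mathcal U}_{\mathbb Z}^{\pm}\subsetneq\tilde{\mathcal U}_{\mathbb Z,M}^{\pm};$$ $$\mathbb Z^{(bin)}[h_0,c]=\mathbb Z^{(bin)}[2\mathfrak h_0,4\tilde c]\subsetneq\mathbb Z^{(bin)}[2\mathfrak h_0,\tilde c-\mathfrak h_0];$$ $$\mathbb Z^{(sym)}[\varepsilon_rh_{\pm r}\mid r>0]\subsetneq\mathbb Z^{(sym)}[\mathfrak h_{\pm r}\mid r>0];\qquad \tilde{\mathcal U}_{\mathbb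 Z}^0\subsetneq\tilde{\mathcal U}_{\mathbb Z,M}^0 .$$ -/

import Mathlib

noncomputable section

namespace A22

/-! ## Integral constructions in an arbitrary `ℚ`-algebra -/

section Integral

variable {U : Type*} [Ring U] [Algebra ℚ U]

/-- The divided power `a^(k) = a^k / k!`. -/
def divPow (a : U) (k : ℕ) : U := ((Nat.factorial k : ℚ)⁻¹) • a ^ k

/-- The binomial `a(a-1)⋯(a-k+1) / k!`. -/
def binom (a : U) (k : ℕ) : U :=
  ((Nat.factorial k : ℚ)⁻¹) • Polynomial.aeval a (descPochhammer ℚ k)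

/-- The exponential `∑ₙ fⁿ/n!` of a power series `f` with zero constant term: the coefficient of
`u^k` only involves the terms with `n ≤ k`. -/
def expSeries (f : PowerSeries U) : PowerSeries U :=
  PowerSeries.mk fun k =>
    ∑ n ∈ Finset.range (k + 1), ((Nat.factorial n : ℚ)⁻¹) • PowerSeries.coeff k (f ^ n)

/-- The series `∑_{r>0} (-1)^(r-1) (p_r / r) u^r`; only the values `p r` with `r > 0` are used. -/
def logSeries (p : ℕ → U) : PowerSeries U :=
  PowerSeries.mk fun r => if r = 0 then 0 else ((-1 : ℚ) ^ (r - 1) / (r : ℚ)) • p r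

/-- The coefficients `p̂_k` of `exp (∑_{r>0} (-1)^(r-1) (p_r / r) u^r)`. -/
def hat (p : ℕ → U) (k : ℕ) : U := PowerSeries.coeff k (expSeries (logSeries p))

/-- `ℤ^(div)[x_i | i ∈ ι]`: the `ℤ`-subalgebra generated by the divided powers of the elements of
the `ℤ`-module `M` spanned by the `x_i`. -/
def zDiv {ι : Type*} (x : ι → U) : Subalgebra ℤ U :=
  Algebra.adjoin ℤ {b | ∃ a ∈ Submodule.span ℤ (Set.range x), ∃ k : ℕ, b = divPow a k}

/-- `ℤ^(bin)[x_i | i ∈ ι]`: the `ℤ`-subalgebra generated by the binomials of the elements of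
the `ℤ`-module `M` spanned by the `x_i`. -/
def zBin {ι : Type*} (x : ι → U) : Subalgebra ℤ U :=
  Algebra.adjoin ℤ {b | ∃ a ∈ Submodule.span ℤ (Set.range x), ∃ k : ℕ, b = binom a k}

/-- `ℤ^(sym)[p_r | r > 0] = ℤ[p̂_k | k > 0]`. -/
def zSym (p : ℕ → U) : Subalgebra ℤ U :=
  Algebra.adjoin ℤ {b | ∃ k : ℕ, 0 < k ∧ b = hat p k}

end Integral

/-! ## The enveloping algebra of type `A₂⁽²⁾` in its Drinfeld presentation -/

/-- The Drinfeld generators. The sign `ε : ℤˣ` stands for `±`, and `X ε k` stands for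
`X_{2k+1}^ε`, the elements `X` being indexed by odd integers only. -/
inductive Gen : Type
  | c : Gen
  | h (r : ℤ) : Gen
  | x (ε : ℤˣ) (r : ℤ) : Gen
  | X (ε : ℤˣ) (k : ℤ) : Gen

/-- The free associative algebra on the Drinfeld generators. -/
abbrev Free := FreeAlgebra ℚ Gen

namespace Free
/-- The free generator `c`. -/
def c : Free := FreeAlgebra.ι ℚ Gen.c
/-- The free generator `h_r`. -/
def h (r : ℤ) : Free := FreeAlgebra.ι ℚ (Gen.h r)
/-- The free generator `x_r^ε`. -/
def x (ε : ℤˣ) (r : ℤ) : Free := FreeAlgebra.ι ℚ (Gen.x ε r)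
/-- The free generator `X_{2k+1}^ε`. -/
def X (ε : ℤˣ) (k : ℤ) : Free := FreeAlgebra.ι ℚ (Gen.X ε k)
/-- The commutator `ab - ba`. -/
def comm (a b : Free) : Free := a * b - b * a
/-- The rational number `± 1` given by a sign. -/
def sgn (ε : ℤˣ) : ℚ := ((ε : ℤ) : ℚ)
end Free

open Free in
/-- The defining relations. -/
inductive Rel : Free → Free → Prop
  | c_central (g : Gen) : Rel (comm c (FreeAlgebra.ι ℚ g)) 0
  | h_h (r s : ℤ) : Rel (comm (h r) (h s))
      (if r + s = 0 then (2 * (r : ℚ) * (2 + (-1 : ℚ) ^ (r - 1))) • c else 0)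
  | h_x (ε : ℤˣ) (r s : ℤ) : Rel (comm (h r) (x ε s))
      ((sgn ε * 2 * (2 + (-1 : ℚ) ^ (r - 1))) • x ε (r + s))
  /- `[h_{2r}, X_{2k+1}^±] = ± 4 X_{2r+2k+1}^±` -/
  | h_X_even (ε : ℤˣ) (r k : ℤ) : Rel (comm (h (2 * r)) (X ε k)) ((sgn ε * 4) • X ε (r + k))
  | h_X_odd (ε : ℤˣ) (r k : ℤ) : Rel (comm (h (2 * r + 1)) (X ε k)) 0
  | x_x_even (ε : ℤˣ) (r s : ℤ) (hrs : Even (r + s)) : Rel (comm (x ε r) (x ε s)) 0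
  /- `[x_r^±, x_s^±] = ± (-1)^s X_{r+s}^±` for `r + s = 2k + 1` -/
  | x_x_odd (ε : ℤˣ) (r s k : ℤ) (hrs : r + s = 2 * k + 1) :
      Rel (comm (x ε r) (x ε s)) ((sgn ε * (-1 : ℚ) ^ s) • X ε k)
  | x_X (ε : ℤˣ) (r k : ℤ) : Rel (comm (x ε r) (X ε k)) 0
  | X_X (ε : ℤˣ) (k l : ℤ) : Rel (comm (X ε k) (X ε l)) 0
  | x_x_opp (r s : ℤ) : Rel (comm (x 1 r) (x (-1) s))
      (h (r + s) + (if r + s = 0 then (r : ℚ) • c else 0))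
  /- `[x_r^±, X_{2k+1}^∓] = ± (-1)^r 4 x_{r+2k+1}^∓` -/
  | x_X_opp (ε : ℤˣ) (r k : ℤ) : Rel (comm (x ε r) (X (-ε) k))
      ((sgn ε * (-1 : ℚ) ^ r * 4) • x (-ε) (r + (2 * k + 1)))
  /- `[X_r^+, X_s^-] = 8 h_{r+s} + 4 δ_{r+s,0} r c` for `r = 2k + 1`, `s = 2l + 1` -/
  | X_X_opp (k l : ℤ) : Rel (comm (X 1 k) (X (-1) l))
      ((8 : ℚ) • h ((2 * k + 1) + (2 * l + 1)) +
        (if (2 * k + 1) + (2 * l + 1) = 0 then (4 * ((2 * k + 1 : ℤ) : ℚ)) • c else 0))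

/-- The associative `ℚ`-algebra `Ũ` with the above generators and relations. -/
def Env : Type := RingQuot Rel

instance : Ring Env := inferInstanceAs (Ring (RingQuot Rel))

instance : Algebra ℚ Env := inferInstanceAs (Algebra ℚ (RingQuot Rel))

/-- The canonical projection from the free algebra. -/
def proj : Free →ₐ[ℚ] Env := RingQuot.mkAlgHom ℚ Rel

/-- The central element `c`. -/
def c : Env := proj Free.c
/-- The element `h_r`. -/
def h (r : ℤ) : Env := proj (Free.h r)
/-- The element `x_r^ε`. -/
def x (ε : ℤˣ) (r : ℤ) : Env := proj (Free.x ε r)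
/-- The element `X_{2k+1}^ε`. -/
def X (ε : ℤˣ) (k : ℤ) : Env := proj (Free.X ε k)

/-- The element `y_{2k+1}^ε = X_{2k+1}^ε / 4`. -/
def y (ε : ℤˣ) (k : ℤ) : Env := (1 / 4 : ℚ) • X ε k
/-- The element `𝒽_r = h_r / 2`. -/
def hh (r : ℤ) : Env := (1 / 2 : ℚ) • h r
/-- The element `c̃ = c / 4`. -/
def cc : Env := (1 / 4 : ℚ) • c

/-! ### Chevalley generators -/

/-- The Chevalley generators `e_0 = X_1^- / 4`, `e_1 = x_0^+`. -/
def chevE : Fin 2 → Env := ![y (-1) 0, x 1 0]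
/-- The Chevalley generators `f_0 = X_{-1}^+ / 4`, `f_1 = x_0^-`. -/
def chevF : Fin 2 → Env := ![y 1 (-1), x (-1) 0]
/-- The Chevalley generators `c / 4 - h_0 / 2` and `h_0` of the Cartan subalgebra. -/
def chevH : Fin 2 → Env := ![cc - hh 0, h 0]
/-- The generalized Cartan matrix of type `A₂⁽²⁾`. -/
def cartan : Matrix (Fin 2) (Fin 2) ℤ := !![2, -1; -4, 2]

/-- The commutator `ab - ba`. -/
def com (a b : Env) : Env := a * b - b * a

theorem com_skew (a b : Env) : -com b a = com a b := by simp [com]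

theorem com_self (a : Env) : com a a = 0 := by simp [com]

theorem com_smul (q : ℚ) (a b : Env) : com a (q • b) = q • com a b := by
  simp [com, smul_sub]

theorem smul_com (q : ℚ) (a b : Env) : com (q • a) b = q • com a b := by
  simp [com, smul_sub]

theorem com_sub (a b d : Env) : com a (b - d) = com a b - com a d := by
  simp only [com]; noncomm_ring

theorem sub_com (a b d : Env) : com (a - b) d = com a d - com b d := by
  simp only [com]; noncomm_ring

theorem com_neg (a b : Env) : com a (-b) = -com a b := by
  simp only [com]; noncomm_ring

theorem proj_comm {a b d : Free} (hr : Rel (Free.comm a b) d) :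
    com (proj a) (proj b) = proj d := by
  have := RingQuot.mkAlgHom_rel ℚ hr
  rw [com, ← map_mul, ← map_mul, ← map_sub]
  exact this

theorem lie_c_x (ε : ℤˣ) (r : ℤ) : com c (x ε r) = 0 := by
  exact (proj_comm (Rel.c_central (Gen.x ε r))).trans (map_zero _)

theorem lie_c_X (ε : ℤˣ) (k : ℤ) : com c (X ε k) = 0 := by
  exact (proj_comm (Rel.c_central (Gen.X ε k))).trans (map_zero _)

theorem lie_c_h (r : ℤ) : com c (h r) = 0 := by
  exact (proj_comm (Rel.c_central (Gen.h r))).trans (map_zero _)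

theorem lie_h_x (ε : ℤˣ) (r s : ℤ) :
    com (h r) (x ε s) = (Free.sgn ε * 2 * (2 + (-1 : ℚ) ^ (r - 1))) • x ε (r + s) := by
  simpa [h, x] using proj_comm (Rel.h_x ε r s)

theorem lie_h_X (ε : ℤˣ) (k : ℤ) : com (h 0) (X ε k) = (Free.sgn ε * 4) • X ε k := by
  simpa [h, X] using proj_comm (Rel.h_X_even ε 0 k)

theorem lie_x_x (ε : ℤˣ) (r s k : ℤ) (hrs : r + s = 2 * k + 1) :
    com (x ε r) (x ε s) = (Free.sgn ε * (-1 : ℚ) ^ s) • X ε k := by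
  simpa [x, X] using proj_comm (Rel.x_x_odd ε r s k hrs)

theorem lie_x_X (ε : ℤˣ) (r k : ℤ) : com (x ε r) (X ε k) = 0 := by
  simpa [x, X] using proj_comm (Rel.x_X ε r k)

theorem lie_x_x_opp (r s : ℤ) :
    com (x 1 r) (x (-1) s) = h (r + s) + (if r + s = 0 then (r : ℚ) • c else 0) := by
  have := proj_comm (Rel.x_x_opp r s)
  split_ifs at this ⊢ <;> simpa [x, h, c] using this

theorem lie_x_X_opp (ε : ℤˣ) (r k : ℤ) :
    com (x ε r) (X (-ε) k) = (Free.sgn ε * (-1 : ℚ) ^ r * 4) • x (-ε) (r + (2 * k + 1)) := by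
  simpa [x, X] using proj_comm (Rel.x_X_opp ε r k)

theorem lie_X_X_opp : com (X 1 (-1)) (X (-1) 0) = (8 : ℚ) • h 0 - (4 : ℚ) • c := by
  have := proj_comm (Rel.X_X_opp (-1) 0)
  norm_num at this
  simpa [X, h, c, sub_eq_add_neg] using this

/-- The elements `chevE`, `chevF`, `chevH` satisfy the Kac-Moody relations of type `A₂⁽²⁾`. -/
theorem chevalley_relations (i j : Fin 2) :
    com (chevH i) (chevH j) = 0 ∧
    com (chevH i) (chevE j) = (cartan i j : ℚ) • chevE j ∧
    com (chevH i) (chevF j) = -((cartan i j : ℚ) • chevF j) ∧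
    com (chevE i) (chevF j) = (if i = j then chevH i else 0) ∧
    (i ≠ j → (com (chevE i))^[(1 - cartan i j).toNat] (chevE j) = 0 ∧
      (com (chevF i))^[(1 - cartan i j).toNat] (chevF j) = 0) := by
  have sm1 : Free.sgn 1 = 1 := by simp [Free.sgn]
  have sm2 : Free.sgn (-1) = -1 := by simp [Free.sgn]
  have hx1 : com (h 0) (x 1 0) = (2 : ℚ) • x 1 0 := by
    rw [lie_h_x, sm1]; norm_num
  have hx2 : com (h 0) (x (-1) 0) = (-2 : ℚ) • x (-1) 0 := by
    rw [lie_h_x, sm2]; norm_num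
  have hX1 : com (h 0) (X 1 (-1)) = (4 : ℚ) • X 1 (-1) := by
    rw [lie_h_X, sm1]; norm_num
  have hX2 : com (h 0) (X (-1) 0) = (-4 : ℚ) • X (-1) 0 := by
    rw [lie_h_X, sm2]; norm_num
  have xx : com (x 1 0) (x (-1) 0) = h 0 := by
    rw [lie_x_x_opp]; simp
  have xX1 : com (x 1 0) (X 1 (-1)) = 0 := lie_x_X _ _ _
  have Xx2 : com (X (-1) 0) (x (-1) 0) = 0 := by rw [← com_skew, lie_x_X, neg_zero]
  have XX : com (X (-1) 0) (X 1 (-1)) = (4 : ℚ) • c - (8 : ℚ) • h 0 := by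
    rw [← com_skew, lie_X_X_opp]; abel
  have a1 : com (x 1 0) (X (-1) 0) = (4 : ℚ) • x (-1) 1 := by
    rw [lie_x_X_opp, sm1]; norm_num
  have b1 : com (x (-1) 0) (X 1 (-1)) = (-4 : ℚ) • x 1 (-1) := by
    have := lie_x_X_opp (-1) 0 (-1)
    rw [neg_neg, sm2] at this
    rw [this]; norm_num
  have a2 : com (x 1 0) (x (-1) 1) = h 1 := by
    rw [lie_x_x_opp]; simp
  have b2 : com (x (-1) 0) (x 1 (-1)) = -h (-1) := by
    rw [← com_skew, lie_x_x_opp]; simp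
  have a3 : com (x 1 0) (h 1) = (-6 : ℚ) • x 1 1 := by
    rw [← com_skew, lie_h_x, sm1, ← neg_smul]; norm_num
  have b3 : com (x (-1) 0) (h (-1)) = (6 : ℚ) • x (-1) (-1) := by
    rw [← com_skew, lie_h_x, sm2, ← neg_smul]; norm_num
  have a4 : com (x 1 0) (x 1 1) = (-1 : ℚ) • X 1 0 := by
    rw [lie_x_x 1 0 1 0 (by norm_num), sm1]; norm_num
  have b4 : com (x (-1) 0) (x (-1) (-1)) = (1 : ℚ) • X (-1) (-1) := by
    rw [lie_x_x (-1) 0 (-1) (-1) (by norm_num), sm2]; norm_num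
  have a5 : com (x 1 0) (X 1 0) = 0 := lie_x_X _ _ _
  have b5 : com (x (-1) 0) (X (-1) (-1)) = 0 := lie_x_X _ _ _
  have c1 : com (X (-1) 0) (x 1 0) = (-4 : ℚ) • x (-1) 1 := by
    rw [← com_skew, a1, ← neg_smul]
  have d1 : com (X 1 (-1)) (x (-1) 0) = (4 : ℚ) • x 1 (-1) := by
    rw [← com_skew, b1, ← neg_smul]; norm_num
  have c2 : com (X (-1) 0) (x (-1) 1) = 0 := by rw [← com_skew, lie_x_X, neg_zero]
  have d2 : com (X 1 (-1)) (x 1 (-1)) = 0 := by rw [← com_skew, lie_x_X, neg_zero]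
  have hc : com (h 0) c = 0 := by rw [← com_skew, lie_c_h, neg_zero]
  fin_cases i <;> fin_cases j <;>
    refine ⟨?_, ?_, ?_, ?_, ?_⟩ <;>
    simp [com_self, com_smul, smul_com, com_sub, sub_com, com_neg, chevH, chevE, chevF, cartan, y,
      hh, cc, lie_c_x, lie_c_X, lie_c_h, hx1, hx2, hX1, hX2, xx, xX1, Xx2, XX, a1, a2, a3, a4, a5, b1, b2, b3, b4, b5, c1, c2, d1, d2, hc, smul_smul,
      Function.iterate_succ] <;>
    try module

/-! ## The Drinfeld-type integral form -/

/-- `Ũ_ℤ`, generated by all the divided powers of the Drinfeld generators `x_r^±`. -/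
def drinfeldForm : Subalgebra ℤ Env :=
  Algebra.adjoin ℤ {b | ∃ (ε : ℤˣ) (r : ℤ) (k : ℕ), b = divPow (x ε r) k}

/-- `Ũ_ℤ^±`. -/
def drinfeldReal (ε : ℤˣ) : Subalgebra ℤ Env :=
  Algebra.adjoin ℤ {b | ∃ (r : ℤ) (k : ℕ), b = divPow (x ε r) k}

/-- The signs `ε_r`: `-1` if `4 ∣ r` and `1` otherwise. -/
def epsSign (r : ℕ) : ℚ := if 4 ∣ r then -1 else 1

/-- `Ũ_ℤ^{0,±} = ℤ^(sym)[ε_r h_{±r} | r > 0]`. -/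
def drinfeldIm (ε : ℤˣ) : Subalgebra ℤ Env :=
  zSym fun r : ℕ => epsSign r • h ((ε : ℤ) * (r : ℤ))

/-- `Ũ_ℤ^{0,0} = ℤ^(bin)[h_0, c]`. -/
def drinfeldCartan : Subalgebra ℤ Env := zBin ![h 0, c]

/-- `Ũ_ℤ^0`, generated by `Ũ_ℤ^{0,-}`, `Ũ_ℤ^{0,0}` and `Ũ_ℤ^{0,+}`. -/
def drinfeldZero : Subalgebra ℤ Env := drinfeldIm (-1) ⊔ drinfeldCartan ⊔ drinfeldIm 1

/-! ## The Mitzman integral form -/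

/-- `Ũ_{ℤ,M}`, generated by all the divided powers of the Chevalley generators. -/
def mitzmanForm : Subalgebra ℤ Env :=
  Algebra.adjoin ℤ {b | ∃ (i : Fin 2) (k : ℕ), b = divPow (chevE i) k ∨ b = divPow (chevF i) k}

/-- `Ũ_{ℤ,M}^±`, the image under multiplication of
`ℤ^(div)[x_{2r}^±] ⊗ ℤ^(div)[y_{2r+1}^±] ⊗ ℤ^(div)[x_{2r+1}^±]`. -/
def mitzmanReal (ε : ℤˣ) : Submodule ℤ Env :=
  (zDiv fun r : ℤ => x ε (2 * r)).toSubmodule * (zDiv fun r : ℤ => y ε r).toSubmodule *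
    (zDiv fun r : ℤ => x ε (2 * r + 1)).toSubmodule

/-- `ℤ^(sym)[𝒽_{±r} | r > 0]`. -/
def mitzmanIm (ε : ℤˣ) : Subalgebra ℤ Env := zSym fun r : ℕ => hh ((ε : ℤ) * (r : ℤ))

/-- `ℤ^(bin)[2𝒽_0, c̃ - 𝒽_0]`. -/
def mitzmanCartan : Subalgebra ℤ Env := zBin ![(2 : ℚ) • hh 0, cc - hh 0]

/-- `Ũ_{ℤ,M}^0`, the image under multiplication of
`ℤ^(sym)[𝒽_{-r}] ⊗ ℤ^(bin)[2𝒽_0, c̃ - 𝒽_0] ⊗ ℤ^(sym)[𝒽_r]`. -/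
def mitzmanZero : Submodule ℤ Env :=
  (mitzmanIm (-1)).toSubmodule * mitzmanCartan.toSubmodule * (mitzmanIm 1).toSubmodule

end A22

end

/-! Containments. `Ũ_ℤ ⊆ Ũ_{ℤ,M}` rests on conjugation by `exp(ue)`: its top coefficient carries
divided powers to divided powers. The `x_0^±`-strings through the Chevalley generators `y_1^-`,
`y_{-1}^+` end at `±`-opposite elements, so all divided powers of `y_{±1}^±` lie in `Ũ_{ℤ,M}`;
bracketing with them shifts the index of `x_r^±` by one, which reaches every `x_r^±`
(`divPow_mem_of_chain`, `divPow_x_shift_mem`).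

The components of the Mitzman form are only products of modules, so the containments for the `±` and
`0` parts need straightening. A product of two generating series is reordered by comparing two
solutions of one first-order equation `u Y' = L Y` (`straighten`); in both cases the commutators are
central, and the extra factor is a divided power of a combination of the `y`'s, respectively a
coefficient of `(1+w)^(2c̃) (1-w)^(-4c̃)`. A product that contains `1` and is stable under left
multiplication by the generators then contains the algebra they generate.

For the symmetric part, let `E(u) = ∑ p̂_k u^k`. Passing from `p_r` to `2 ε_r p_r` replaces `E(u)`
by `E(u)² / (E(u)E(-u)E(iu)E(-iu))`, whose coefficients are integral polynomials in the `p̂_k`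
(`hatSeries_eps_mul`).

Strictness. Each inclusion is separated by a level zero representation in which the smaller algebra
preserves an integrality condition. In the natural representation of the twisted loop algebra
evaluated at `t = i`, certain entries stay in `ℤ + 2ℤi` while `y_1^±` and `𝔥_{±1}` produce `±i`.
There `h_0` has only even weights, so the Cartan part needs another module: monomials with exponents
in `(1/2,0,0) + ℤ³`, where `h_0` has the eigenvalue `1` and hence `c̃ - 𝔥_0` the eigenvalue `-1/2`.
-/

noncomputable section

namespace A22

open PowerSeries Finset

/-! ## The Euler operator on power series with noncommuting coefficients -/

section Euler

variable {U : Type*} [Ring U]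

/-- The Euler operator `u d/du`. -/
def euler : PowerSeries U →+ PowerSeries U where
  toFun f := PowerSeries.mk fun n => n • coeff n f
  map_zero' := by ext n; simp
  map_add' f g := by ext n; simp

@[simp]
theorem coeff_euler (n : ℕ) (f : PowerSeries U) : coeff n (euler f) = n • coeff n f := by
  simp [euler]

theorem euler_mul (f g : PowerSeries U) : euler (f * g) = euler f * g + f * euler g := by
  ext n
  simp only [coeff_euler, map_add, coeff_mul, smul_sum, ← sum_add_distrib]
  refine sum_congr rfl fun p hp => ?_
  rw [← mem_antidiagonal.1 hp, add_smul, smul_mul_assoc, mul_smul_comm]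

@[simp]
theorem euler_one : euler (1 : PowerSeries U) = 0 := by
  ext n; simp only [coeff_euler, coeff_one]; split_ifs with h <;> simp [h]

@[simp]
theorem euler_C (a : U) : euler (C a : PowerSeries U) = 0 := by
  ext n; simp only [coeff_euler, coeff_C]; split_ifs with h <;> simp [h]

theorem euler_monomial (n : ℕ) (a : U) : euler (monomial n a) = n • monomial n a := by
  ext m; simp only [coeff_euler, coeff_monomial, map_nsmul]; split_ifs with h <;> simp [h]

theorem euler_pow {f : PowerSeries U} (hf : Commute f (euler f)) (n : ℕ) :
    euler (f ^ (n + 1)) = (n + 1) • (euler f * f ^ n) := by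
  induction n with
  | zero => simp
  | succ n ih =>
    rw [pow_succ, euler_mul, ih, smul_mul_assoc, mul_assoc, ← pow_succ, (hf.pow_left (n + 1)).eq,
      succ_nsmul _ (n + 1)]

/-- Two series commute as soon as their coefficients do. -/
theorem commute_of_coeff {f g : PowerSeries U} (h : ∀ i j, Commute (coeff i f) (coeff j g)) :
    Commute f g := by
  ext n
  rw [coeff_mul, coeff_mul, ← Finset.Nat.sum_antidiagonal_swap]
  exact sum_congr rfl fun p _ => h _ _

theorem coeff_pow_eq_zero {f : PowerSeries U} (hf : coeff 0 f = 0) {n k : ℕ} (hk : k < n) :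
    coeff k (f ^ n) = 0 := by
  induction n generalizing k with
  | zero => omega
  | succ n ih =>
    rw [pow_succ', coeff_mul]
    refine sum_eq_zero fun p hp => ?_
    have := mem_antidiagonal.1 hp
    rcases Nat.eq_zero_or_pos p.1 with h | h
    · rw [h, hf, zero_mul]
    · rw [ih (by omega), mul_zero]

/-- The substitution `f(w) ↦ f(uv)`, a series in `v` with coefficients series in `u`. -/
def diagSeries : PowerSeries U →+ PowerSeries (PowerSeries U) where
  toFun f := PowerSeries.mk fun n => monomial n (coeff n f)
  map_zero' := by ext n; simp
  map_add' f g := by ext n; simp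

theorem coeff_diagSeries (n : ℕ) (f : PowerSeries U) :
    coeff n (diagSeries f) = monomial n (coeff n f) := by simp [diagSeries]

theorem diagSeries_mul (f g : PowerSeries U) :
    diagSeries (f * g) = diagSeries f * diagSeries g := by
  ext1 n
  rw [coeff_diagSeries, coeff_mul, coeff_mul, map_sum]
  refine sum_congr rfl fun p hp => ?_
  rw [coeff_diagSeries, coeff_diagSeries, monomial_mul_monomial, mem_antidiagonal.1 hp]

theorem euler_diagSeries (f : PowerSeries U) : euler (diagSeries f) = diagSeries (euler f) := by
  ext1 n
  rw [coeff_euler, coeff_diagSeries, coeff_diagSeries, coeff_euler, map_nsmul]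

theorem euler_map {V : Type*} [Ring V] (φ : U →+* V) (f : PowerSeries U) :
    euler (PowerSeries.map φ f) = PowerSeries.map φ (euler f) := by
  ext n; simp

theorem coeff_succ_monomial_one_mul (a : U) (f : PowerSeries U) (n : ℕ) :
    coeff (n + 1) (monomial 1 a * f) = a * coeff n f := by
  have : (monomial 1 a : PowerSeries U) = PowerSeries.X * C a := by
    rw [X_eq, ← monomial_zero_eq_C_apply, monomial_mul_monomial, one_mul]
  rw [this, mul_assoc, coeff_succ_X_mul, coeff_C_mul]

theorem coeff_succ_mul_monomial_one (a : U) (f : PowerSeries U) (n : ℕ) :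
    coeff (n + 1) (f * monomial 1 a) = coeff n f * a := by
  have : (monomial 1 a : PowerSeries U) = C a * PowerSeries.X := by
    rw [X_eq, ← monomial_zero_eq_C_apply, monomial_mul_monomial, mul_one]
  rw [this, ← mul_assoc, coeff_succ_mul_X, coeff_mul_C]

theorem coeff_zero_monomial_one (a : U) : coeff 0 (monomial 1 a : PowerSeries U) = 0 := by
  rw [coeff_monomial, if_neg zero_ne_one]

theorem coeff_zero_mul' (f g : PowerSeries U) : coeff 0 (f * g) = coeff 0 f * coeff 0 g := by
  rw [coeff_mul, Finset.Nat.antidiagonal_zero, sum_singleton]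

variable [Algebra ℚ U]

/-- A solution of `u Y' = L Y`, where `L` has no constant term, is determined by its constant
term. -/
theorem euler_ode_unique {L Y Z : PowerSeries U} (hL : coeff 0 L = 0) (hY : euler Y = L * Y)
    (hZ : euler Z = L * Z) (h0 : coeff 0 Y = coeff 0 Z) : Y = Z := by
  ext n
  induction n using Nat.strong_induction_on with
  | _ n ih =>
  rcases Nat.eq_zero_or_pos n with rfl | hn
  · exact h0
  -- As `L` has no constant term, the coefficient of `u^n` in `L Y` involves only coefficients of
  -- `Y` below `n`; dividing by `n` uses the rational scalars.
  have key : n • coeff n Y = n • coeff n Z := by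
    rw [← coeff_euler, ← coeff_euler, hY, hZ, coeff_mul, coeff_mul]
    refine sum_congr rfl fun p hp => ?_
    have := mem_antidiagonal.1 hp
    rcases Nat.eq_zero_or_pos p.1 with h | h
    · rw [h, hL, zero_mul, zero_mul]
    · rw [ih p.2 (by omega)]
  have := congrArg (fun z : U => ((n : ℚ)⁻¹) • z) key
  have hn' : (n : ℚ) ≠ 0 := by exact_mod_cast hn.ne'
  simpa [← Nat.cast_smul_eq_nsmul ℚ, smul_smul, hn'] using this

theorem coeff_zero_expSeries (f : PowerSeries U) : coeff 0 (expSeries f) = 1 := by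
  simp [expSeries]

/-- `f ^ n` starts in degree `n`, so the cutoff in `expSeries` may be raised at will. This gives one
common cutoff for all the coefficients occurring in a product. -/
theorem coeff_expSeries {f : PowerSeries U} (hf : coeff 0 f = 0) {k N : ℕ} (hk : k ≤ N) :
    coeff k (expSeries f) =
      ∑ n ∈ range (N + 1), ((Nat.factorial n : ℚ)⁻¹) • coeff k (f ^ n) := by
  rw [expSeries, coeff_mk]
  refine sum_subset (range_mono (by omega)) fun n _ hn => ?_
  rw [coeff_pow_eq_zero hf (by simpa using hn), smul_zero]

/-- The coefficients need not commute, so the power rule, and with it this chain rule, requires `f`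
to commute with its own derivative. -/
theorem euler_expSeries {f : PowerSeries U} (hf : coeff 0 f = 0) (hc : Commute f (euler f)) :
    euler (expSeries f) = euler f * expSeries f := by
  ext k
  have hR : coeff k (euler f * expSeries f) =
      ∑ n ∈ range (k + 1), ((Nat.factorial n : ℚ)⁻¹) • coeff k (euler f * f ^ n) := by
    rw [coeff_mul]
    simp only [coeff_mul, smul_sum]
    rw [sum_comm]
    refine sum_congr rfl fun p hp => ?_
    rw [coeff_expSeries (N := k) hf (by have := mem_antidiagonal.1 hp; omega), mul_sum]
    simp only [mul_smul_comm]
  -- Differentiation lowers the summation index by one; the unmatched term `n = k` vanishes, because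
  -- `euler f * f ^ k` starts in degree `k + 1`.
  have h0 : coeff k (euler f * f ^ k) = 0 := by
    rw [coeff_mul]
    refine sum_eq_zero fun p hp => ?_
    have := mem_antidiagonal.1 hp
    rcases Nat.eq_zero_or_pos p.1 with h | h
    · rw [h, coeff_euler, zero_smul, zero_mul]
    · rw [coeff_pow_eq_zero hf (by omega), mul_zero]
  rw [hR, sum_range_succ, h0, smul_zero, add_zero, coeff_euler, coeff_expSeries hf le_rfl,
    sum_range_succ', smul_add, smul_sum]
  have h1 : k • ((Nat.factorial 0 : ℚ)⁻¹) • coeff k (f ^ 0) = 0 := by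
    rw [pow_zero, coeff_one]; split_ifs with h <;> simp [h]
  rw [h1, add_zero]
  refine sum_congr rfl fun n _ => ?_
  rw [smul_comm, ← coeff_euler, euler_pow hc, map_nsmul, ← Nat.cast_smul_eq_nsmul ℚ, smul_smul,
    Nat.factorial_succ]
  congr 1
  have : ((n : ℚ) + 1) ≠ 0 := by positivity
  push_cast
  field_simp

/-! ## Straightening in two variables -/

/-- If conjugation by `e(u)` adds `K_s u^s` to the coefficients `P_s` of the logarithmic derivative
of `F(v)`, then `e(u) F(v) = F(v) Θ(uv) e(u)`, where `K` is the logarithmic derivative of `Θ`. -/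
theorem straighten {e F P Θ K : PowerSeries U} (hF : euler F = P * F) (hF0 : coeff 0 F = 1)
    (hP0 : coeff 0 P = 0) (hΘ : euler Θ = K * Θ) (hΘ0 : coeff 0 Θ = 1) (hK0 : coeff 0 K = 0)
    (hKF : ∀ i j, Commute (coeff i K) (coeff j F))
    (he : ∀ s, e * C (coeff s P) = (C (coeff s P) + monomial s (coeff s K)) * e) :
    C e * PowerSeries.map C F = PowerSeries.map C F * diagSeries Θ * C e := by
  -- Both sides solve `v ∂_v Y = (P(v) + K(uv)) Y`: on the left `e(u)` is moved past `P(v)`, on the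
  -- right `K(uv)` is moved past `F(v)`.
  refine euler_ode_unique (L := PowerSeries.map C P + diagSeries K) ?_ ?_ ?_ ?_
  · rw [map_add, coeff_map, coeff_diagSeries, hP0, hK0, map_zero, map_zero, add_zero]
  · rw [euler_mul, euler_C, zero_mul, zero_add, euler_map, hF, map_mul, ← mul_assoc, ← mul_assoc]
    congr 1
    ext1 s
    rw [coeff_C_mul, coeff_mul_C, map_add, coeff_map, coeff_diagSeries, he]
  · have hcomm : Commute (diagSeries K) (PowerSeries.map C F) := by
      refine commute_of_coeff fun i j => ?_
      rw [coeff_diagSeries, coeff_map]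
      refine commute_of_coeff fun a b => ?_
      rw [coeff_monomial, coeff_C]
      split_ifs
      exacts [hKF i j, Commute.zero_right _, Commute.zero_left _, Commute.zero_left _]
    rw [euler_mul, euler_mul, euler_C, mul_zero, add_zero, euler_map, hF, map_mul,
      euler_diagSeries, hΘ, diagSeries_mul, ← mul_assoc (PowerSeries.map C F), ← hcomm.eq]
    noncomm_ring
  · rw [coeff_C_mul, coeff_mul_C, coeff_mul, Finset.Nat.antidiagonal_zero, sum_singleton,
      coeff_map, coeff_diagSeries, hF0, hΘ0]
    simp

/-- Comparing the coefficients of `u^k v^l` in the straightening identity writes `e_k F_l` as a sum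
of products `F_i Θ_j e_m` with no denominators. -/
theorem straighten_mem {e F P Θ K : PowerSeries U} (hF : euler F = P * F) (hF0 : coeff 0 F = 1)
    (hP0 : coeff 0 P = 0) (hΘ : euler Θ = K * Θ) (hΘ0 : coeff 0 Θ = 1) (hK0 : coeff 0 K = 0)
    (hKF : ∀ i j, Commute (coeff i K) (coeff j F))
    (he : ∀ s, e * C (coeff s P) = (C (coeff s P) + monomial s (coeff s K)) * e)
    (N : Submodule ℤ U) (hN : ∀ i j m, coeff i F * coeff j Θ * coeff m e ∈ N) (k l : ℕ) :
    coeff k e * coeff l F ∈ N := by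
  have := congrArg (fun z => coeff k (coeff l z)) (straighten hF hF0 hP0 hΘ hΘ0 hK0 hKF he)
  simp only [coeff_C_mul, coeff_map, coeff_mul_C] at this
  rw [this, coeff_mul l, sum_mul, map_sum]
  refine N.sum_mem fun p _ => ?_
  rw [coeff_map, coeff_diagSeries, mul_assoc, coeff_C_mul, coeff_mul, mul_sum]
  refine N.sum_mem fun q _ => ?_
  rw [coeff_monomial]
  split_ifs
  · rw [← mul_assoc]; exact hN _ _ _
  · simp

end Euler

/-! ## Submodule forms of straightening -/

section Straighten

variable {U : Type*} [Ring U]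

theorem submodule_mul_comm {E Y : Submodule ℤ U} (h : ∀ a ∈ E, ∀ b ∈ Y, a * b = b * a) :
    E * Y = Y * E := by
  apply le_antisymm
  · exact Submodule.mul_le.2 fun a ha b hb => h a ha b hb ▸ Submodule.mul_mem_mul hb ha
  · exact Submodule.mul_le.2 fun b hb a ha => h a ha b hb ▸ Submodule.mul_mem_mul ha hb

theorem adjoin_commute {s t : Set U} (h : ∀ a ∈ s, ∀ b ∈ t, a * b = b * a) :
    ∀ a ∈ Algebra.adjoin ℤ s, ∀ b ∈ Algebra.adjoin ℤ t, a * b = b * a := by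
  have h1 : ∀ a ∈ s, ∀ b ∈ Algebra.adjoin ℤ t, a * b = b * a := by
    intro a ha b hb
    have : Algebra.adjoin ℤ t ≤ Subalgebra.centralizer ℤ {a} :=
      Algebra.adjoin_le fun b hb => Subalgebra.mem_centralizer_iff ℤ |>.2 fun g hg => by
        rw [Set.mem_singleton_iff.1 hg]; exact h a ha b hb
    exact Subalgebra.mem_centralizer_iff ℤ |>.1 (this hb) a rfl
  intro a ha b hb
  have : Algebra.adjoin ℤ s ≤ Subalgebra.centralizer ℤ {b} :=
    Algebra.adjoin_le fun a ha => Subalgebra.mem_centralizer_iff ℤ |>.2 fun g hg => by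
      rw [Set.mem_singleton_iff.1 hg]; exact (h1 a ha b hb).symm
  exact (Subalgebra.mem_centralizer_iff ℤ |>.1 (this ha) b rfl).symm

theorem subalgebra_mul_self (E : Subalgebra ℤ U) :
    E.toSubmodule * E.toSubmodule = E.toSubmodule := E.isIdempotentElem_toSubmodule

/-- Moving `B` through the subalgebra generated by `s`, at the cost of factors in `Y`. -/
theorem mul_adjoin_le {s : Set U} {B : Submodule ℤ U} {Y : Subalgebra ℤ U}
    (hY : ∀ a ∈ s, ∀ b ∈ Y, a * b = b * a)
    (hs : ∀ a ∈ s, ∀ b ∈ B, b * a ∈ (Algebra.adjoin ℤ s).toSubmodule * Y.toSubmodule * B) :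
    B * (Algebra.adjoin ℤ s).toSubmodule ≤
      (Algebra.adjoin ℤ s).toSubmodule * Y.toSubmodule * B := by
  set E := Algebra.adjoin ℤ s with hE
  have hEY : E.toSubmodule * Y.toSubmodule = Y.toSubmodule * E.toSubmodule := by
    refine submodule_mul_comm fun a ha b hb => ?_
    refine adjoin_commute (t := Y) hY a ha b ?_
    rwa [Algebra.adjoin_eq]
  have hEE := subalgebra_mul_self E
  have hYY := subalgebra_mul_self Y
  have h1E : (1 : Submodule ℤ U) ≤ E.toSubmodule := Submodule.one_le.2 E.one_mem
  have h1Y : (1 : Submodule ℤ U) ≤ Y.toSubmodule := Submodule.one_le.2 Y.one_mem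
  refine Submodule.mul_le.2 fun b hb a ha => ?_
  change a ∈ Algebra.adjoin ℤ s at ha
  induction ha using Algebra.adjoin_induction generalizing b with
  | mem a ha => exact hs a ha b hb
  | algebraMap r =>
    rw [← Algebra.commutes]
    refine Submodule.mul_mem_mul ?_ hb
    rw [← mul_one (algebraMap ℤ U r)]
    exact Submodule.mul_mem_mul (E.algebraMap_mem r) Y.one_mem
  | add a a' _ _ h h' => rw [mul_add]; exact add_mem (h b hb) (h' b hb)
  | mul a a' _ _ h h' =>
    -- The fixed factor `a'` is replaced by the line it spans, so that the rest is a computation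
    -- with products of submodules: `E Y B a' ⊆ E Y E Y B = E Y B`.
    have hB' : B * Submodule.span ℤ {a'} ≤ E.toSubmodule * Y.toSubmodule * B := by
      refine Submodule.mul_le.2 fun m hm n hn => ?_
      obtain ⟨z, rfl⟩ := Submodule.mem_span_singleton.1 hn
      rw [mul_smul_comm]
      exact Submodule.smul_mem _ _ (h' m hm)
    have hB : E.toSubmodule * Y.toSubmodule * B * Submodule.span ℤ {a'} ≤
        E.toSubmodule * Y.toSubmodule * B := by
      calc E.toSubmodule * Y.toSubmodule * B * Submodule.span ℤ {a'}
          = E.toSubmodule * Y.toSubmodule * (B * Submodule.span ℤ {a'}) := by rw [mul_assoc]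
        _ ≤ E.toSubmodule * Y.toSubmodule * (E.toSubmodule * Y.toSubmodule * B) := by
            exact mul_le_mul' le_rfl hB'
        _ = E.toSubmodule * (Y.toSubmodule * E.toSubmodule) * Y.toSubmodule * B := by
            simp only [mul_assoc]
        _ = (E.toSubmodule * E.toSubmodule) * (Y.toSubmodule * Y.toSubmodule) * B := by
            rw [← hEY]; simp only [mul_assoc]
        _ = E.toSubmodule * Y.toSubmodule * B := by rw [hEE, hYY]
    rw [← mul_assoc]
    exact hB (Submodule.mul_mem_mul (h b hb) (Submodule.mem_span_singleton_self a'))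

/-- A submodule containing `1` and stable under left multiplication by generators contains the
generated subalgebra. -/
theorem adjoin_le_submodule {s : Set U} {N : Submodule ℤ U} (h1 : 1 ∈ N)
    (hs : ∀ a ∈ s, ∀ n ∈ N, a * n ∈ N) : (Algebra.adjoin ℤ s).toSubmodule ≤ N := by
  intro a ha
  have : ∀ n ∈ N, a * n ∈ N := by
    change a ∈ Algebra.adjoin ℤ s at ha
    induction ha using Algebra.adjoin_induction with
    | mem a ha => exact hs a ha
    | algebraMap r => intro n hn; rw [← Algebra.smul_def]; exact N.smul_mem r hn
    | add a a' _ _ h h' => intro n hn; rw [add_mul]; exact add_mem (h n hn) (h' n hn)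
    | mul a a' _ _ h h' => intro n hn; rw [mul_assoc]; exact h _ (h' n hn)
  simpa using this 1 h1

theorem span_commute {s t : Set U} (h : ∀ a ∈ s, ∀ b ∈ t, Commute a b) {a b : U}
    (ha : a ∈ Submodule.span ℤ s) (hb : b ∈ Submodule.span ℤ t) : Commute a b :=
  adjoin_commute (fun a ha b hb => h a ha b hb) a (Algebra.span_le_adjoin ℤ s ha) b
    (Algebra.span_le_adjoin ℤ t hb)

/-- Stability of a product `E Y O` under left multiplication by part of `O`. -/
theorem mul_triple_le {s : Set U} {B : Submodule ℤ U} {Y O : Subalgebra ℤ U}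
    (hY : ∀ a ∈ s, ∀ b ∈ Y, a * b = b * a)
    (hs : ∀ a ∈ s, ∀ b ∈ B, b * a ∈ (Algebra.adjoin ℤ s).toSubmodule * Y.toSubmodule * B)
    (hBO : B ≤ O.toSubmodule) (hBY : ∀ b ∈ B, ∀ y ∈ Y, b * y = y * b) :
    B * ((Algebra.adjoin ℤ s).toSubmodule * Y.toSubmodule * O.toSubmodule) ≤
      (Algebra.adjoin ℤ s).toSubmodule * Y.toSubmodule * O.toSubmodule := by
  have h := mul_adjoin_le hY hs
  set E := (Algebra.adjoin ℤ s).toSubmodule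
  have hc : B * Y.toSubmodule = Y.toSubmodule * B := submodule_mul_comm hBY
  have hYY := subalgebra_mul_self Y
  have hOO := subalgebra_mul_self O
  calc B * (E * Y.toSubmodule * O.toSubmodule)
      = (B * E) * (Y.toSubmodule * O.toSubmodule) := by simp only [mul_assoc]
    _ ≤ (E * Y.toSubmodule * B) * (Y.toSubmodule * O.toSubmodule) := mul_le_mul' h le_rfl
    _ = E * Y.toSubmodule * (B * Y.toSubmodule) * O.toSubmodule := by simp only [mul_assoc]
    _ = E * (Y.toSubmodule * Y.toSubmodule) * (B * O.toSubmodule) := by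
        rw [hc]; simp only [mul_assoc]
    _ ≤ E * (Y.toSubmodule * Y.toSubmodule) * (O.toSubmodule * O.toSubmodule) :=
        mul_le_mul' le_rfl (mul_le_mul' hBO le_rfl)
    _ = E * Y.toSubmodule * O.toSubmodule := by rw [hYY, hOO]

end Straighten

/-! ## The coefficients `p̂_k` -/

section Hat

variable {U : Type*} [Ring U] [Algebra ℚ U]

/-- The generating series `∑ p̂_k u^k`. -/
def hatSeries (p : ℕ → U) : PowerSeries U := expSeries (logSeries p)

/-- The logarithmic derivative `∑_{r>0} (-1)^(r-1) p_r u^r` of `∑ p̂_k u^k`. -/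
def newtonSeries (p : ℕ → U) : PowerSeries U :=
  PowerSeries.mk fun r => if r = 0 then 0 else ((-1 : ℚ) ^ (r - 1)) • p r

theorem coeff_newtonSeries_zero (p : ℕ → U) : coeff 0 (newtonSeries p) = 0 := by
  rw [newtonSeries, coeff_mk, if_pos rfl]

theorem coeff_newtonSeries (p : ℕ → U) {r : ℕ} (hr : r ≠ 0) :
    coeff r (newtonSeries p) = ((-1 : ℚ) ^ (r - 1)) • p r := by
  rw [newtonSeries, coeff_mk, if_neg hr]

theorem coeff_logSeries_zero (p : ℕ → U) : coeff 0 (logSeries p) = 0 := by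
  rw [logSeries, coeff_mk, if_pos rfl]

theorem euler_logSeries (p : ℕ → U) : euler (logSeries p) = newtonSeries p := by
  ext r
  rw [coeff_euler, logSeries, newtonSeries, coeff_mk, coeff_mk]
  split_ifs with h
  · simp
  · rw [← Nat.cast_smul_eq_nsmul ℚ, smul_smul]
    congr 1
    have : (r : ℚ) ≠ 0 := by exact_mod_cast h
    field_simp

theorem coeff_zero_hatSeries (p : ℕ → U) : coeff 0 (hatSeries p) = 1 := coeff_zero_expSeries _

theorem coeff_hatSeries (p : ℕ → U) (k : ℕ) : coeff k (hatSeries p) = hat p k := rfl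

theorem commute_coeff_newtonSeries {p : ℕ → U} {a : U} (ha : ∀ r, Commute a (p r)) (r : ℕ) :
    Commute a (coeff r (newtonSeries p)) := by
  rw [newtonSeries, coeff_mk]
  split_ifs
  · exact Commute.zero_right _
  · exact (ha r).smul_right _

theorem euler_hatSeries {p : ℕ → U} (hp : ∀ r s, Commute (p r) (p s)) :
    euler (hatSeries p) = newtonSeries p * hatSeries p := by
  have hc : Commute (logSeries p) (euler (logSeries p)) := by
    refine commute_of_coeff fun i j => ?_
    rw [euler_logSeries]
    refine commute_coeff_newtonSeries (fun r => ?_) j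
    rw [logSeries, coeff_mk]
    split_ifs
    · exact Commute.zero_left _
    · exact (hp i r).smul_left _
  rw [hatSeries, euler_expSeries (coeff_logSeries_zero p) hc, euler_logSeries]

/-- Closed forms for `∑ p̂_k u^k` are obtained from here: a candidate only needs constant term `1`
and the right logarithmic derivative. -/
theorem hatSeries_eq_of_ode {p : ℕ → U} (hp : ∀ r s, Commute (p r) (p s)) {Y : PowerSeries U}
    (h0 : coeff 0 Y = 1) (hY : euler Y = newtonSeries p * Y) : hatSeries p = Y :=
  euler_ode_unique (coeff_newtonSeries_zero p) (euler_hatSeries hp) hY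
    ((coeff_zero_hatSeries p).trans h0.symm)

theorem map_hat {V : Type*} [Ring V] [Algebra ℚ V] (φ : U →ₐ[ℚ] V) (p : ℕ → U) (k : ℕ) :
    φ (hat p k) = hat (fun r => φ (p r)) k := by
  have hl : PowerSeries.map (φ : U →+* V) (logSeries p) = logSeries fun r => φ (p r) := by
    ext r
    rw [coeff_map, logSeries, logSeries, coeff_mk, coeff_mk]
    split_ifs <;> simp
  simp only [hat, expSeries, coeff_mk, map_sum, map_smul, ← hl, ← map_pow, coeff_map]
  rfl

theorem map_divPow {V : Type*} [Ring V] [Algebra ℚ V] (φ : U →ₐ[ℚ] V) (a : U) (k : ℕ) :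
    φ (divPow a k) = divPow (φ a) k := by
  simp [divPow]

theorem map_binom {V : Type*} [Ring V] [Algebra ℚ V] (φ : U →ₐ[ℚ] V) (a : U) (k : ℕ) :
    φ (binom a k) = binom (φ a) k := by
  rw [binom, binom, map_smul, Polynomial.aeval_algHom_apply]

/-- Elements commuting with all `p_r` commute with all `p̂_k`. -/
theorem commute_hat {p : ℕ → U} {a : U} (ha : ∀ r, Commute a (p r)) (k : ℕ) :
    Commute a (hat p k) := by
  have hp : ∀ n, Commute (C a) (logSeries p ^ n) := fun n => by
    refine Commute.pow_right (commute_of_coeff fun i j => ?_) n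
    rw [coeff_C, logSeries, coeff_mk]
    split_ifs
    exacts [Commute.zero_right _, (ha j).smul_right _, Commute.zero_right _, Commute.zero_left _]
  rw [hat, expSeries, coeff_mk]
  refine Commute.sum_right _ _ _ fun n _ => Commute.smul_right ?_ _
  have := congrArg (coeff k) (hp n).eq
  rwa [coeff_C_mul, coeff_mul_C] at this

end Hat

/-! ### Symmetric functions: integrality under `p_r ↦ 2 ε_r p_r` -/

section Symmetric

variable {A : Type*} [CommRing A]

theorem epsSign_cases (r : ℕ) :
    (r % 2 = 1 ∧ epsSign r = 1) ∨ (r % 4 = 2 ∧ epsSign r = 1) ∨ (r % 4 = 0 ∧ epsSign r = -1) := by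
  unfold epsSign
  split_ifs <;> simp <;> omega

/-- The series `f(u)` with `u^2` replaced by `-u^2`, for an even series `f`. -/
def twistSeries (f : PowerSeries A) : PowerSeries A :=
  PowerSeries.mk fun n => (-1) ^ (n / 2) * coeff n f

theorem euler_twistSeries (f : PowerSeries A) : euler (twistSeries f) = twistSeries (euler f) := by
  ext n
  simp only [coeff_euler, twistSeries, coeff_mk, mul_smul_comm]

/-- Because of the rounding in `n / 2`, the twist is multiplicative only when one factor is even;
then the halves of the two exponents add up exactly. -/
theorem twistSeries_mul {f : PowerSeries A} (hf : ∀ n, Odd n → coeff n f = 0)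
    (g : PowerSeries A) : twistSeries (f * g) = twistSeries f * twistSeries g := by
  ext n
  simp only [twistSeries, coeff_mk, coeff_mul, mul_sum]
  refine sum_congr rfl fun p hp => ?_
  have hn := mem_antidiagonal.1 hp
  rcases Nat.even_or_odd p.1 with ⟨m, hm⟩ | h
  · have : n / 2 = p.1 / 2 + p.2 / 2 := by omega
    rw [this, pow_add]; ring
  · rw [hf _ h]; ring

/-- `f(u) f(-u)`. -/
def evenNorm (f : PowerSeries A) : PowerSeries A := f * rescale (-1) f

/-- `f(u) f(-u) f(iu) f(-iu)`. -/
def fourNorm (f : PowerSeries A) : PowerSeries A := evenNorm f * twistSeries (evenNorm f)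

theorem euler_rescale (f : PowerSeries A) :
    euler (rescale (-1) f) = rescale (-1) (euler f) := by
  ext n
  simp only [coeff_euler, coeff_rescale, mul_smul_comm]

theorem rescale_neg_one_twice (f : PowerSeries A) : rescale (-1) (rescale (-1) f) = f := by
  ext n
  rw [coeff_rescale, coeff_rescale, ← mul_assoc, ← mul_pow]
  simp

/-- Dividing by a series with constant term `1` keeps the coefficients in a subring. -/
theorem coeff_mem_of_mul_mem (S : Subring A) {f g : PowerSeries A} (hg0 : coeff 0 g = 1)
    (hg : ∀ n, coeff n g ∈ S) (hfg : ∀ n, coeff n (f * g) ∈ S) (n : ℕ) : coeff n f ∈ S := by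
  induction n using Nat.strong_induction_on with
  | _ n ih =>
  have h := hfg n
  rw [coeff_mul, Finset.Nat.sum_antidiagonal_eq_sum_range_succ_mk, sum_range_succ, Nat.sub_self,
    hg0, mul_one] at h
  refine (S.add_mem_cancel_left (S.sum_mem fun i hi => ?_)).1 h
  exact S.mul_mem (ih i (mem_range.1 hi)) (hg _)

theorem coeff_mul_mem (S : Subring A) {f g : PowerSeries A} (hf : ∀ n, coeff n f ∈ S)
    (hg : ∀ n, coeff n g ∈ S) (n : ℕ) : coeff n (f * g) ∈ S := by
  rw [coeff_mul]
  exact S.sum_mem fun q _ => S.mul_mem (hf _) (hg _)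

theorem coeff_zero_fourNorm {f : PowerSeries A} (h0 : coeff 0 f = 1) :
    coeff 0 (fourNorm f) = 1 := by
  simp only [fourNorm, evenNorm, twistSeries, coeff_mul, Finset.Nat.antidiagonal_zero,
      sum_singleton, coeff_rescale, coeff_mk, h0]
  simp

variable [Algebra ℚ A]

theorem coeff_odd_eq_zero {f : PowerSeries A} (hf : rescale (-1) f = f) {n : ℕ} (hn : Odd n) :
    coeff n f = 0 := by
  have h := congrArg (coeff n) hf
  rw [coeff_rescale, hn.neg_one_pow] at h
  have h2 : (2 : ℚ) • coeff n f = 0 := by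
    rw [two_smul]; nth_rewrite 1 [← h]; ring
  simpa using h2

/-- Compare logarithmic derivatives. With `P` that of `E`, the two norms contribute `P(u) + P(-u)`
and its twist by `u² ↦ -u²`. The twist stands for `E(iu)E(-iu)` without adjoining `i`. -/
theorem hatSeries_eps_mul (p : ℕ → A) :
    hatSeries (fun r => epsSign r • (2 : ℚ) • p r) * fourNorm (hatSeries p) = hatSeries p ^ 2 := by
  set E := hatSeries p with hE
  set P := newtonSeries p with hP
  have eE : euler E = P * E := euler_hatSeries fun _ _ => Commute.all _ _
  have eN : euler (evenNorm E) = (P + rescale (-1) P) * evenNorm E := by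
    rw [evenNorm, euler_mul, euler_rescale, eE, map_mul]; ring
  have hodd : ∀ n, Odd n → coeff n (P + rescale (-1) P) = 0 := fun n hn =>
    coeff_odd_eq_zero (by rw [map_add, rescale_neg_one_twice, add_comm]) hn
  have eT : euler (twistSeries (evenNorm E)) =
      twistSeries (P + rescale (-1) P) * twistSeries (evenNorm E) := by
    rw [euler_twistSeries, eN, twistSeries_mul hodd]
  have eH := euler_hatSeries (p := fun r => epsSign r • (2 : ℚ) • p r) fun _ _ => Commute.all _ _
  -- Up to the common factor `(-1)^(r-1) p_r`, the three terms are `2 + 0 + 0` for odd `r`, `2 + 2 -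
  -- 2` for `r ≡ 2 mod 4`, and `-2 + 2 + 2` for `4 ∣ r`. This is what dictates the signs `ε_r`.
  have key : newtonSeries (fun r => epsSign r • (2 : ℚ) • p r) + (P + rescale (-1) P) +
      twistSeries (P + rescale (-1) P) = 2 * P := by
    ext r
    rw [two_mul]
    rcases Nat.eq_zero_or_pos r with rfl | hr
    · simp only [map_add, twistSeries, coeff_mk, coeff_rescale, coeff_newtonSeries_zero, hP]; simp
    · simp only [map_add, twistSeries, coeff_mk, coeff_rescale, coeff_newtonSeries _ hr.ne', hP]
      rcases epsSign_cases r with ⟨h, e⟩ | ⟨h, e⟩ | ⟨h, e⟩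
      · have h1 : Odd r := Nat.odd_iff.2 h
        rw [h1.neg_one_pow, e]; simp only [neg_one_mul, add_neg_cancel, mul_zero]; module
      · have h1 : Even r := Nat.even_iff.2 (by omega)
        have h2 : Odd (r / 2) := Nat.odd_iff.2 (by omega)
        rw [h1.neg_one_pow, h2.neg_one_pow, e]; simp only [neg_one_mul, one_mul]; module
      · have h1 : Even r := Nat.even_iff.2 (by omega)
        have h2 : Even (r / 2) := Nat.even_iff.2 (by omega)
        rw [h1.neg_one_pow, h2.neg_one_pow, e]; simp only [one_mul]; module
  have h0 : coeff 0 E = 1 := coeff_zero_hatSeries p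
  refine euler_ode_unique (L := 2 * P) ?_ ?_ ?_ ?_
  · rw [two_mul, map_add, hP, coeff_newtonSeries_zero, add_zero]
  · rw [fourNorm, euler_mul, euler_mul, eH, eN, eT, ← key]; ring
  · rw [pow_two, euler_mul, eE]; ring
  · simp only [fourNorm, evenNorm, twistSeries, pow_two, coeff_mul, Finset.Nat.antidiagonal_zero,
      sum_singleton, coeff_rescale, coeff_mk, h0, coeff_zero_hatSeries]
    simp

/-- Only `E²` and the fourfold norm need coefficients in `S`, not `E` itself. This sharper form is
what places the Drinfeld elements in an order that misses `p̂_1`. -/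
theorem hat_eps_mem_of_fourNorm (S : Subring A) (p : ℕ → A)
    (h2 : ∀ n, coeff n (hatSeries p ^ 2) ∈ S) (h4 : ∀ n, coeff n (fourNorm (hatSeries p)) ∈ S)
    (k : ℕ) : hat (fun r => epsSign r • (2 : ℚ) • p r) k ∈ S := by
  refine coeff_mem_of_mul_mem S (coeff_zero_fourNorm (coeff_zero_hatSeries p)) h4 ?_ k
  intro n
  exact hatSeries_eps_mul p ▸ h2 n

theorem hat_eps_mem (S : Subring A) (p : ℕ → A) (hS : ∀ k, hat p k ∈ S) (k : ℕ) :
    hat (fun r => epsSign r • (2 : ℚ) • p r) k ∈ S := by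
  have hneg : ∀ n : ℕ, (-1 : A) ^ n ∈ S := fun n => S.pow_mem (S.neg_mem S.one_mem) n
  have hN : ∀ n, coeff n (evenNorm (hatSeries p)) ∈ S := coeff_mul_mem S hS fun n => by
    rw [coeff_rescale]; exact S.mul_mem (hneg n) (hS n)
  refine hat_eps_mem_of_fourNorm S p (fun n => ?_) (coeff_mul_mem S hN fun n => ?_) k
  · rw [pow_two]; exact coeff_mul_mem S hS hS n
  · rw [twistSeries, coeff_mk]; exact S.mul_mem (hneg _) (hN n)

end Symmetric

/-- `ℤ^(sym)[2 ε_r p_r] ⊆ ℤ^(sym)[p_r]` for commuting `p_r`. -/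
theorem zSym_eps_le {U : Type*} [Ring U] [Algebra ℚ U] {p : ℕ → U}
    (hp : ∀ r s, Commute (p r) (p s)) :
    zSym (fun r => epsSign r • (2 : ℚ) • p r) ≤ zSym p := by
  -- The identity of series was proved over commutative rings, so it is applied in the commutative
  -- `ℚ`-algebra generated by the `p_r`, to the preimage of `zSym p`.
  have : IsMulCommutative (Algebra.adjoin ℚ (Set.range p)) :=
    Algebra.isMulCommutative_adjoin ℚ (by rintro _ ⟨r, rfl⟩ _ ⟨s, rfl⟩; exact hp r s)
  let _ : CommRing (Algebra.adjoin ℚ (Set.range p)) :=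
    { (inferInstance : Ring (Algebra.adjoin ℚ (Set.range p))) with mul_comm := this.is_comm.comm }
  let φ : Algebra.adjoin ℚ (Set.range p) →ₐ[ℚ] U := (Algebra.adjoin ℚ (Set.range p)).val
  let q : ℕ → Algebra.adjoin ℚ (Set.range p) := fun r =>
    ⟨p r, Algebra.subset_adjoin (Set.mem_range_self r)⟩
  have hq : ∀ r, φ (q r) = p r := fun r => rfl
  refine Algebra.adjoin_le ?_
  rintro _ ⟨k, -, rfl⟩
  let S : Subring (Algebra.adjoin ℚ (Set.range p)) := (zSym p).toSubring.comap (φ : _ →+* U)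
  have h1 : ∀ k, hat q k ∈ S := fun k => by
    change φ (hat q k) ∈ zSym p
    rw [map_hat]
    rcases Nat.eq_zero_or_pos k with rfl | hk
    · have := coeff_zero_hatSeries (fun r => φ (q r))
      rw [coeff_hatSeries] at this
      rw [this]; exact one_mem _
    · exact Algebra.subset_adjoin ⟨k, hk, rfl⟩
  have h2 : φ (hat (fun r => epsSign r • (2 : ℚ) • q r) k) ∈ zSym p := hat_eps_mem S q h1 k
  rw [map_hat] at h2
  simpa [hq] using h2

/-! ## Divided powers -/

section DivPow

variable {U : Type*} [Ring U] [Algebra ℚ U]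

/-- The series `∑ a^(k) u^k`. -/
def divSeries (a : U) : PowerSeries U := PowerSeries.mk (divPow a)

@[simp]
theorem coeff_divSeries (a : U) (k : ℕ) : coeff k (divSeries a) = divPow a k := coeff_mk _ _

@[simp]
theorem divPow_zero (a : U) : divPow a 0 = 1 := by simp [divPow]

@[simp]
theorem divPow_one (a : U) : divPow a 1 = a := by simp [divPow]

theorem divPow_neg (a : U) (k : ℕ) : divPow (-a) k = ((-1 : ℤ) ^ k) • divPow a k := by
  rcases Nat.even_or_odd k with h | h <;> simp [divPow, h.neg_pow]

theorem commute_divPow {a b : U} (h : Commute a b) (k l : ℕ) :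
    Commute (divPow a k) (divPow b l) :=
  ((h.pow_pow k l).smul_left _).smul_right _

theorem nsmul_divPow_succ (a : U) (k : ℕ) : (k + 1) • divPow a (k + 1) = a * divPow a k := by
  rw [divPow, divPow, pow_succ', mul_smul_comm, ← Nat.cast_smul_eq_nsmul ℚ, smul_smul,
    Nat.factorial_succ]
  congr 1
  have : ((k : ℚ) + 1) ≠ 0 := by positivity
  push_cast
  field_simp

theorem euler_divSeries (a : U) : euler (divSeries a) = monomial 1 a * divSeries a := by
  ext n
  rcases n with _ | n
  · rw [coeff_euler, zero_smul, coeff_zero_mul', coeff_zero_monomial_one, zero_mul]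
  · rw [coeff_euler, coeff_succ_monomial_one_mul, coeff_divSeries, coeff_divSeries,
      nsmul_divPow_succ]

/-- The Heisenberg straightening `b^(k) a^(l) = ∑ a^(l-j) z^(j) b^(k-j)` for `z = [b, a]`
central. -/
theorem divPow_mul_divPow_mem {a b z : U} (h : b * a = a * b + z) (hza : Commute z a)
    (hzb : Commute z b) (N : Submodule ℤ U)
    (hN : ∀ i j m, divPow a i * divPow z j * divPow b m ∈ N) (k l : ℕ) :
    divPow b k * divPow a l ∈ N := by
  -- In terms of series this is `exp(ub) a = (a + uz) exp(ub)`, the conjugation hypothesis of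
  -- `straighten_mem` with `P = av` and `K = zw`.
  have key : ∀ k, divPow b (k + 1) * a = a * divPow b (k + 1) + z * divPow b k := by
    intro k
    have hk : ∀ k : ℕ, b ^ (k + 1) * a = a * b ^ (k + 1) + (k + 1) • (z * b ^ k) := by
      intro k
      induction k with
      | zero => simpa using h
      | succ k ih =>
        rw [pow_succ', mul_assoc, ih, mul_add, ← mul_assoc, h, mul_smul_comm, ← mul_assoc b z,
          ← hzb.eq, mul_assoc z, ← pow_succ', succ_nsmul _ (k + 1), add_mul, mul_assoc a,
          ← pow_succ']
        abel
    rw [divPow, smul_mul_assoc, hk, smul_add, ← mul_smul_comm, ← divPow]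
    congr 1
    rw [divPow, mul_smul_comm, ← Nat.cast_smul_eq_nsmul ℚ, smul_smul, Nat.factorial_succ]
    congr 1
    have : ((k : ℚ) + 1) ≠ 0 := by positivity
    push_cast
    field_simp
  have := straighten_mem (e := divSeries b) (euler_divSeries a) (by simp)
    (coeff_zero_monomial_one a) (euler_divSeries z) (by simp) (coeff_zero_monomial_one z)
    (fun i j => ?_) (fun s => ?_) N ?_ k l
  · simpa using this
  · rw [coeff_monomial, coeff_divSeries]
    split_ifs
    · exact (hza.pow_right j).smul_right _
    · exact Commute.zero_left _
  · rw [coeff_monomial, coeff_monomial]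
    split_ifs with hs
    · subst hs
      ext n
      rw [coeff_mul_C, add_mul, map_add, coeff_C_mul]
      rcases n with _ | n
      · rw [coeff_zero_mul', coeff_zero_monomial_one]; simp
      · rw [coeff_succ_monomial_one_mul]
        simpa using key n
    · simp
  · simpa using hN

theorem divSeries_mul_divSeries_neg (a : U) : divSeries a * divSeries (-a) = 1 := by
  have hc : Commute (divSeries a) (monomial 1 a) := by
    refine commute_of_coeff fun i j => ?_
    rw [coeff_divSeries, coeff_monomial]
    split_ifs
    · exact ((Commute.refl a).pow_left i).smul_left _
    · exact Commute.zero_right _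
  refine euler_ode_unique (L := 0) (map_zero _) ?_ (by simp) ?_
  · rw [euler_mul, euler_divSeries, euler_divSeries, ← mul_assoc, map_neg, mul_neg, hc.eq]
    noncomm_ring
  · rw [coeff_zero_mul']; simp

/-- The top term of `exp(ad e)` maps divided powers to divided powers: if
`w_n = (ad e)^(n) z` vanishes for `n > m`, then `(w_m)^(k) = (ad e)^(mk) z^(k)`. -/
theorem divPow_mem_of_chain {M : Subalgebra ℤ U} {e : U} (he : ∀ k, divPow e k ∈ M) {w : ℕ → U}
    (hz : ∀ k, divPow (w 0) k ∈ M)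
    (hw : ∀ n : ℕ, e * w n - w n * e = ((n : ℚ) + 1) • w (n + 1)) {m : ℕ}
    (hm : ∀ n, m < n → w n = 0) (k : ℕ) : divPow (w m) k ∈ M := by
  -- `A a = exp(ue) a exp(-ue) = exp(u ad e)(a)`. It is multiplicative, being a conjugation, and it
  -- visibly preserves `M` coefficientwise.
  set A : U → PowerSeries U := fun a => divSeries e * C a * divSeries (-e) with hA
  have hinv : divSeries (-e) * divSeries e = 1 := by
    simpa using divSeries_mul_divSeries_neg (-e)
  have hcoe : ∀ n, coeff n (A (w 0)) = w n := by
    have hc : Commute (monomial 1 e) (divSeries (-e)) := by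
      refine commute_of_coeff fun i j => ?_
      rw [coeff_divSeries, coeff_monomial]
      split_ifs
      · exact (((Commute.refl e).neg_right).pow_right j).smul_right _
      · exact Commute.zero_left _
    have hode : euler (A (w 0)) = monomial 1 e * A (w 0) - A (w 0) * monomial 1 e := by
      simp only [hA]
      rw [euler_mul, euler_mul, euler_C, mul_zero, add_zero, euler_divSeries, euler_divSeries,
        map_neg, mul_assoc _ _ (monomial 1 e), ← hc.eq]
      noncomm_ring
    intro n
    induction n with
    | zero => simp only [hA]; rw [coeff_zero_mul', coeff_zero_mul']; simp
    | succ n ih =>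
      have h1 := congrArg (coeff (n + 1)) hode
      rw [map_sub, coeff_succ_monomial_one_mul, coeff_succ_mul_monomial_one, ih, hw, coeff_euler,
        ← Nat.cast_smul_eq_nsmul ℚ] at h1
      have h2 : ((n : ℚ) + 1) ≠ 0 := by positivity
      push_cast at h1
      exact smul_right_injective U h2 h1
  have hpow : ∀ a k, A (a ^ k) = A a ^ k := by
    intro a k
    induction k with
    | zero => simpa [hA] using divSeries_mul_divSeries_neg e
    | succ k ih =>
      rw [pow_succ, pow_succ, ← ih]
      simp only [hA, map_mul]
      calc _ = divSeries e * C (a ^ k) * 1 * C a * divSeries (-e) := by noncomm_ring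
        _ = _ := by rw [← hinv]; noncomm_ring
  -- `A (w 0)` is a polynomial of degree at most `m` whose coefficient at `u^m` is `w m`, so the
  -- coefficient of its `k`-th power at `u^(mk)` is `w m ^ k`.
  have htop : ∀ k, (∀ n, m * k < n → coeff n (A (w 0) ^ k) = 0) ∧
      coeff (m * k) (A (w 0) ^ k) = w m ^ k := by
    intro k
    induction k with
    | zero =>
      refine ⟨fun n hn => ?_, ?_⟩
      · rw [pow_zero, coeff_one, if_neg (by omega)]
      · simp
    | succ k ih =>
      refine ⟨fun n hn => ?_, ?_⟩
      · rw [pow_succ, coeff_mul]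
        refine sum_eq_zero fun p hp => ?_
        have := mem_antidiagonal.1 hp
        rcases lt_or_ge (m * k) p.1 with h | h
        · rw [ih.1 _ h, zero_mul]
        · rw [hcoe, hm p.2 (by rw [mul_add] at hn; omega), mul_zero]
      · rw [pow_succ, coeff_mul, sum_eq_single (m * k, m), ih.2, hcoe, pow_succ]
        · intro p hp hne
          have := mem_antidiagonal.1 hp
          rw [mul_add] at this
          rcases lt_trichotomy (m * k) p.1 with h | h | h
          · rw [ih.1 _ h, zero_mul]
          · exact absurd (Prod.ext h.symm (by simp only; omega)) hne
          · rw [hcoe, hm p.2 (by omega), mul_zero]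
        · intro h
          exact absurd (HasAntidiagonal.mem_antidiagonal.2 (by ring)) h
  have hmem : coeff (m * k) (A (divPow (w 0) k)) ∈ M := by
    simp only [hA]
    rw [coeff_mul]
    refine M.sum_mem fun p _ => ?_
    rw [coeff_mul_C, coeff_divSeries, coeff_divSeries, divPow_neg]
    exact M.mul_mem (M.mul_mem (he _) (hz _)) (M.zsmul_mem (he _) _)
  have hsm : A (divPow (w 0) k) = ((Nat.factorial k : ℚ)⁻¹) • A (w 0) ^ k := by
    rw [← hpow]
    simp only [hA, divPow]
    ext n
    simp only [coeff_smul, coeff_mul _ _ (divSeries (-e)), coeff_mul_C, mul_smul_comm,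
      smul_mul_assoc, smul_sum]
  rw [hsm, coeff_smul, (htop k).2] at hmem
  exact hmem

/-- The chain `z, w, 0`: a single bracket that `ad e` then annihilates. -/
theorem divPow_mem_of_com {M : Subalgebra ℤ U} {e z w : U} (he : ∀ k, divPow e k ∈ M)
    (hz : ∀ k, divPow z k ∈ M) (h1 : e * z - z * e = w) (h2 : e * w - w * e = 0) (k : ℕ) :
    divPow w k ∈ M := by
  refine divPow_mem_of_chain (w := fun n => if n = 0 then z else if n = 1 then w else 0) (m := 1)
    he hz (fun n => ?_) (fun n hn => ?_) k
  · rcases n with _ | _ | n <;> simp [h1, h2]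
  · rw [if_neg (by omega), if_neg (by omega)]

/-- The factors `2, 3, 4` make `a_n` the divided power `(ad e)^(n) a₀`. Length four is that of the
string of a short root vector running from `-2α` to `2α`. -/
theorem divPow_mem_of_chain_four {M : Subalgebra ℤ U} {e a₀ a₁ a₂ a₃ a₄ : U}
    (he : ∀ k, divPow e k ∈ M) (hz : ∀ k, divPow a₀ k ∈ M)
    (h0 : e * a₀ - a₀ * e = a₁) (h1 : e * a₁ - a₁ * e = (2 : ℚ) • a₂)
    (h2 : e * a₂ - a₂ * e = (3 : ℚ) • a₃) (h3 : e * a₃ - a₃ * e = (4 : ℚ) • a₄)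
    (h4 : e * a₄ - a₄ * e = 0) (k : ℕ) : divPow a₄ k ∈ M := by
  refine divPow_mem_of_chain (w := fun n => match n with
    | 0 => a₀ | 1 => a₁ | 2 => a₂ | 3 => a₃ | 4 => a₄ | _ => 0) (m := 4)
    he hz (fun n => ?_) (fun n hn => ?_) k
  · rcases n with _ | _ | _ | _ | _ | n <;>
    first
    | (change e * (0 : U) - 0 * e = _ • (0 : U); simp)
    | norm_num [h0, h1, h2, h3, h4]
  · rcases n with _ | _ | _ | _ | _ | n <;> first | omega | rfl

theorem zDiv_commute {ι κ : Type*} {x : ι → U} {y : κ → U} (h : ∀ i j, Commute (x i) (y j)) :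
    ∀ a ∈ zDiv x, ∀ b ∈ zDiv y, a * b = b * a := by
  refine adjoin_commute ?_
  rintro _ ⟨a, ha, k, rfl⟩ _ ⟨b, hb, l, rfl⟩
  refine commute_divPow (span_commute ?_ ha hb) k l
  rintro _ ⟨i, rfl⟩ _ ⟨j, rfl⟩
  exact h i j

theorem divPow_mem_zDiv {ι : Type*} (x : ι → U) {a : U}
    (ha : a ∈ Submodule.span ℤ (Set.range x)) (k : ℕ) : divPow a k ∈ zDiv x :=
  Algebra.subset_adjoin ⟨a, ha, k, rfl⟩

end DivPow

/-! ## The positive and negative parts -/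

theorem com_eq_zero_iff {a b : Env} : com a b = 0 ↔ Commute a b := sub_eq_zero

theorem sgn_cases (ε : ℤˣ) : Free.sgn ε = 1 ∨ Free.sgn ε = -1 := by
  rcases Int.units_eq_one_or ε with rfl | rfl <;> simp [Free.sgn]

theorem commute_x_X (ε : ℤˣ) (r k : ℤ) : Commute (x ε r) (X ε k) :=
  com_eq_zero_iff.1 (lie_x_X ε r k)

theorem commute_x_y (ε : ℤˣ) (r k : ℤ) : Commute (x ε r) (y ε k) :=
  (commute_x_X ε r k).smul_right _

theorem X_eq_smul_y (ε : ℤˣ) (k : ℤ) : X ε k = (4 : ℤ) • y ε k := by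
  rw [y, ← Int.cast_smul_eq_zsmul ℚ, smul_smul]; norm_num

theorem X_mem_span_y (ε : ℤˣ) (k : ℤ) :
    X ε k ∈ Submodule.span ℤ (Set.range fun r : ℤ => y ε r) := by
  rw [X_eq_smul_y]
  exact Submodule.smul_mem _ _ (Submodule.subset_span ⟨k, rfl⟩)

/-- The brackets of odd with even `x`'s are `±X = ±4y`. The whole span is treated because `zDiv`
contains the divided powers of arbitrary integral combinations. -/
theorem exists_com_eq (ε : ℤˣ) {r : ℤ} (hr : Odd r) {a : Env}
    (ha : a ∈ Submodule.span ℤ (Set.range fun s : ℤ => x ε (2 * s))) :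
    ∃ z ∈ Submodule.span ℤ (Set.range fun s : ℤ => y ε s), x ε r * a = a * x ε r + z := by
  induction ha using Submodule.span_induction with
  | mem a ha =>
    obtain ⟨s, rfl⟩ := ha
    obtain ⟨k, rfl⟩ := hr
    refine ⟨Free.sgn ε • X ε (k + s), ?_, ?_⟩
    · rcases sgn_cases ε with h | h <;> rw [h]
      · rw [one_smul]; exact X_mem_span_y _ _
      · rw [neg_smul, one_smul]; exact neg_mem (X_mem_span_y _ _)
    · have h := lie_x_x ε (2 * k + 1) (2 * s) (k + s) (by ring)
      rw [(even_two_mul s).neg_one_zpow, mul_one] at h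
      rw [← h, com]; simp
  | zero => exact ⟨0, zero_mem _, by simp⟩
  | add a b _ _ iha ihb =>
    obtain ⟨z, hz, ez⟩ := iha
    obtain ⟨w, hw, ew⟩ := ihb
    exact ⟨z + w, add_mem hz hw, by rw [mul_add, ez, ew]; noncomm_ring⟩
  | smul n a _ iha =>
    obtain ⟨z, hz, ez⟩ := iha
    exact ⟨n • z, Submodule.smul_mem _ _ hz, by rw [mul_smul_comm, ez, smul_add, smul_mul_assoc]⟩

/-- The product `E Y O` absorbs divided powers of even `x_r` into `E`. Those of an odd `x_r` cross
`E` by the Heisenberg formula, leave divided powers in `Y`, commute with `Y`, and end up in `O`. -/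
theorem drinfeldReal_le_mitzmanReal (ε : ℤˣ) :
    (drinfeldReal ε).toSubmodule ≤ mitzmanReal ε := by
  set E := zDiv fun r : ℤ => x ε (2 * r) with hE
  set Y := zDiv fun r : ℤ => y ε r with hY
  set O := zDiv fun r : ℤ => x ε (2 * r + 1) with hO
  have hEY : ∀ a ∈ E, ∀ b ∈ Y, a * b = b * a := zDiv_commute fun i j => commute_x_y _ _ _
  have hOY : ∀ a ∈ O, ∀ b ∈ Y, a * b = b * a := zDiv_commute fun i j => commute_x_y _ _ _
  refine adjoin_le_submodule ?_ ?_
  · have := Submodule.mul_mem_mul (Submodule.mul_mem_mul (M := E.toSubmodule)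
      (N := Y.toSubmodule) E.one_mem Y.one_mem) (N := O.toSubmodule) O.one_mem
    rw [mul_one, mul_one] at this
    exact this
  rintro _ ⟨r, k, rfl⟩ n hn
  rcases Int.even_or_odd r with ⟨s, rfl⟩ | hr
  · have h1 : divPow (x ε (s + s)) k ∈ E.toSubmodule :=
      divPow_mem_zDiv _ (Submodule.subset_span ⟨s, by rw [two_mul]⟩) k
    have h2 := Submodule.mul_mem_mul h1 hn
    rw [mitzmanReal, ← mul_assoc, ← mul_assoc, ← hE, subalgebra_mul_self] at h2
    exact h2
  · have hxO : x ε r ∈ Submodule.span ℤ (Set.range fun r : ℤ => x ε (2 * r + 1)) := by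
      obtain ⟨s, rfl⟩ := hr
      exact Submodule.subset_span ⟨s, rfl⟩
    -- Spanning by the divided powers of one `x_r` keeps `b` fixed in the Heisenberg formula, which
    -- returns divided powers of that same `b`.
    set B := Submodule.span ℤ (Set.range fun k => divPow (x ε r) k) with hB
    have hBO : B ≤ O.toSubmodule := Submodule.span_le.2 <| by
      rintro _ ⟨k, rfl⟩; exact divPow_mem_zDiv _ hxO k
    refine mul_triple_le (B := B) (Y := Y) (O := O)
      (fun a ha b hb => hEY a (Algebra.subset_adjoin ha) b hb) ?_ hBO
      (fun b hb z hz => hOY b (hBO hb) z hz)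
      (Submodule.mul_mem_mul (Submodule.subset_span ⟨k, rfl⟩) hn)
    rintro _ ⟨a, ha, l, rfl⟩ b hb
    obtain ⟨z, hz, ez⟩ := exists_com_eq ε hr ha
    have hza : Commute z a := span_commute
      (by rintro _ ⟨i, rfl⟩ _ ⟨j, rfl⟩; exact (commute_x_y _ _ _).symm) hz ha
    have hzb : Commute z (x ε r) := span_commute (t := {x ε r})
      (by rintro _ ⟨i, rfl⟩ _ rfl; exact (commute_x_y _ _ _).symm) hz
      (Submodule.mem_span_singleton_self _)
    induction hb using Submodule.span_induction with
    | mem b hb =>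
      obtain ⟨k, rfl⟩ := hb
      refine divPow_mul_divPow_mem ez hza hzb _ (fun i j m => ?_) k l
      exact Submodule.mul_mem_mul (Submodule.mul_mem_mul (divPow_mem_zDiv _ ha i)
        (divPow_mem_zDiv _ hz j)) (Submodule.subset_span ⟨m, rfl⟩)
    | zero => rw [zero_mul]; exact zero_mem _
    | add b b' _ _ h h' => rw [add_mul]; exact add_mem h h'
    | smul n b _ h => rw [smul_mul_assoc]; exact Submodule.smul_mem _ _ h

/-! ## The Drinfeld form is contained in the Mitzman form -/

theorem divPow_neg_mem {M : Subalgebra ℤ Env} {a : Env} (h : ∀ k, divPow (-a) k ∈ M) (k : ℕ) :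
    divPow a k ∈ M := by
  have := M.zsmul_mem (h k) ((-1) ^ k)
  rwa [← divPow_neg, neg_neg] at this

/-- `ad y_{2m+1}^ε` sends `x_r^{-ε}` to `±x_{r+2m+1}^ε` and kills the result, so the chain of length
one applies; the sign is harmless for divided powers. -/
theorem divPow_x_shift_mem {M : Subalgebra ℤ Env} {ε : ℤˣ} {r m : ℤ}
    (hy : ∀ k, divPow (y ε m) k ∈ M) (hx : ∀ k, divPow (x (-ε) r) k ∈ M) (k : ℕ) :
    divPow (x ε (r + (2 * m + 1))) k ∈ M := by
  have h := lie_x_X_opp (-ε) r m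
  rw [neg_neg] at h
  have h1 : com (y ε m) (x (-ε) r) =
      (-(Free.sgn (-ε) * (-1 : ℚ) ^ r)) • x ε (r + (2 * m + 1)) := by
    rw [← com_skew, y, com_smul, h]; module
  have h2 : com (y ε m) ((-(Free.sgn (-ε) * (-1 : ℚ) ^ r)) • x ε (r + (2 * m + 1))) = 0 :=
    com_eq_zero_iff.2 ((commute_x_y _ _ _).symm.smul_right _)
  have h3 := divPow_mem_of_com hy hx h1 h2
  have h4 : -(Free.sgn (-ε) * (-1 : ℚ) ^ r) = 1 ∨ -(Free.sgn (-ε) * (-1 : ℚ) ^ r) = -1 := by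
    rcases sgn_cases (-ε) with e | e <;> rcases Int.even_or_odd r with h | h <;>
      simp [e, h.neg_one_zpow]
  rcases h4 with e | e <;> rw [e] at h3
  · simpa using h3 k
  · exact divPow_neg_mem (by simpa using h3) k

/-- Here `m = 0, -1` are the indices `1, -1`. Two of the four elements are Chevalley generators. The
others end the strings `y_1^-, x_1^-, 𝔥_1, -x_1^+, y_1^+` under `x_0^+` and `y_{-1}^+, -x_{-1}^+,
𝔥_{-1}, x_{-1}^-, y_{-1}^-` under `x_0^-`. -/
theorem divPow_y_mem_mitzmanForm (ε : ℤˣ) {m : ℤ} (hm : m = 0 ∨ m = -1) (k : ℕ) :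
    divPow (y ε m) k ∈ mitzmanForm := by
  have hx1 : ∀ k, divPow (x 1 0) k ∈ mitzmanForm := fun k =>
    Algebra.subset_adjoin ⟨1, k, Or.inl rfl⟩
  have hx2 : ∀ k, divPow (x (-1) 0) k ∈ mitzmanForm := fun k =>
    Algebra.subset_adjoin ⟨1, k, Or.inr rfl⟩
  have hy1 : ∀ k, divPow (y 1 (-1)) k ∈ mitzmanForm := fun k =>
    Algebra.subset_adjoin ⟨0, k, Or.inr rfl⟩
  have hy2 : ∀ k, divPow (y (-1) 0) k ∈ mitzmanForm := fun k =>
    Algebra.subset_adjoin ⟨0, k, Or.inl rfl⟩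
  have sm1 : Free.sgn 1 = 1 := by simp [Free.sgn]
  have sm2 : Free.sgn (-1) = -1 := by simp [Free.sgn]
  rcases Int.units_eq_one_or ε with rfl | rfl <;> rcases hm with rfl | rfl
  · refine divPow_mem_of_chain_four (a₁ := x (-1) 1) (a₂ := hh 1) (a₃ := -x 1 1) hx1 hy2
      ?_ ?_ ?_ ?_ ?_ k
    · change com _ _ = _
      rw [y, com_smul, lie_x_X_opp, sm1, smul_smul]; norm_num
    · change com _ _ = _
      rw [lie_x_x_opp, hh, smul_smul]; norm_num
    · change com _ _ = _
      rw [hh, com_smul, ← com_skew, lie_h_x, sm1, smul_neg, smul_neg, smul_smul]; norm_num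
    · change com _ _ = _
      rw [com_neg, lie_x_x 1 0 1 0 (by norm_num), sm1, y, smul_smul]; norm_num
    · change com _ _ = _
      rw [y, com_smul, lie_x_X, smul_zero]
  · exact hy1 k
  · exact hy2 k
  · refine divPow_mem_of_chain_four (a₁ := -x 1 (-1)) (a₂ := hh (-1)) (a₃ := x (-1) (-1)) hx2 hy1
      ?_ ?_ ?_ ?_ ?_ k
    · change com _ _ = _
      have := lie_x_X_opp (-1) 0 (-1)
      rw [neg_neg, sm2] at this
      rw [y, com_smul, this, smul_smul]; norm_num
    · change com _ _ = _
      rw [com_neg, com_skew, lie_x_x_opp, hh, smul_smul]; norm_num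
    · change com _ _ = _
      rw [hh, com_smul, ← com_skew, lie_h_x, sm2, smul_neg, smul_smul, ← neg_smul]; norm_num
    · change com _ _ = _
      rw [lie_x_x (-1) 0 (-1) (-1) (by norm_num), sm2, y, smul_smul]; norm_num
    · change com _ _ = _
      rw [y, com_smul, lie_x_X, smul_zero]

/-- Induction away from `r = 0`: bracketing with `y_1^ε` or `y_{-1}^ε` moves the index by one and
flips the sign of the root, so both signs are carried together. -/
theorem drinfeldForm_le_mitzmanForm : drinfeldForm ≤ mitzmanForm := by
  have key : ∀ r : ℤ, ∀ (ε : ℤˣ) (k : ℕ), divPow (x ε r) k ∈ mitzmanForm := by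
    intro r
    induction r using Int.induction_on with
    | zero =>
      intro ε k
      rcases Int.units_eq_one_or ε with rfl | rfl
      · exact Algebra.subset_adjoin ⟨1, k, Or.inl rfl⟩
      · exact Algebra.subset_adjoin ⟨1, k, Or.inr rfl⟩
    | succ r ih =>
      intro ε k
      have := divPow_x_shift_mem (divPow_y_mem_mitzmanForm ε (Or.inl rfl)) (ih (-ε)) k
      simpa using this
    | pred r ih =>
      intro ε k
      have := divPow_x_shift_mem (divPow_y_mem_mitzmanForm ε (Or.inr rfl)) (ih (-ε)) k
      norm_num at this
      exact this
  refine Algebra.adjoin_le ?_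
  rintro _ ⟨ε, r, k, rfl⟩
  exact key r ε k

/-! ## Binomial series -/

section Binomial

variable {U : Type*} [Ring U]

/-- The series `f(-u)`. -/
def altSeries (f : PowerSeries U) : PowerSeries U :=
  PowerSeries.mk fun n => (-1 : ℤ) ^ n • coeff n f

theorem coeff_altSeries (f : PowerSeries U) (n : ℕ) :
    coeff n (altSeries f) = (-1 : ℤ) ^ n • coeff n f := coeff_mk _ _

theorem altSeries_mul (f g : PowerSeries U) : altSeries (f * g) = altSeries f * altSeries g := by
  ext n
  simp only [coeff_altSeries, coeff_mul, smul_sum]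
  refine sum_congr rfl fun p hp => ?_
  rw [← HasAntidiagonal.mem_antidiagonal.1 hp, pow_add, smul_mul_smul_comm]

theorem euler_altSeries (f : PowerSeries U) : euler (altSeries f) = altSeries (euler f) := by
  ext n
  rw [coeff_euler, coeff_altSeries, coeff_altSeries, coeff_euler, smul_comm]

theorem one_add_X_mul_cancel {f g : PowerSeries U}
    (h : (1 + PowerSeries.X) * f = (1 + PowerSeries.X) * g) : f = g := by
  ext n
  induction n with
  | zero =>
    have := congrArg (coeff 0) h
    simpa [add_mul, coeff_zero_mul'] using this
  | succ n ih =>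
    have := congrArg (coeff (n + 1)) h
    simpa [add_mul, coeff_succ_X_mul, ih] using this

variable [Algebra ℚ U]

/-- The series `(1 + u)^a = ∑ binom(a, k) u^k`. -/
def binSeries (a : U) : PowerSeries U := PowerSeries.mk (binom a)

@[simp]
theorem coeff_binSeries (a : U) (k : ℕ) : coeff k (binSeries a) = binom a k := coeff_mk _ _

@[simp]
theorem binom_zero (a : U) : binom a 0 = 1 := by simp [binom]

@[simp]
theorem binom_one (a : U) : binom a 1 = a := by simp [binom]

theorem nsmul_binom_succ (a : U) (k : ℕ) :
    (k + 1) • binom a (k + 1) = a * binom a k - k • binom a k := by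
  have h : Polynomial.aeval a (descPochhammer ℚ (k + 1)) =
      a * Polynomial.aeval a (descPochhammer ℚ k) -
        (k : ℚ) • Polynomial.aeval a (descPochhammer ℚ k) := by
    rw [descPochhammer_succ_right, mul_comm, map_mul, map_sub, Polynomial.aeval_X, map_natCast,
      sub_mul]
    simp [Algebra.smul_def]
  have hk : ((k : ℚ) + 1) ≠ 0 := by positivity
  rw [binom, binom, h, mul_smul_comm, ← Nat.cast_smul_eq_nsmul ℚ, ← Nat.cast_smul_eq_nsmul ℚ,
    smul_comm (k : ℚ), ← smul_sub, smul_smul, Nat.factorial_succ]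
  congr 1
  push_cast
  field_simp

theorem commute_binom {a b : U} (h : Commute a b) (k : ℕ) : Commute a (binom b k) := by
  rw [binom, Polynomial.aeval_eq_sum_range]
  exact Commute.smul_right (Commute.sum_right _ _ _ fun i _ => (h.pow_right i).smul_right _) _

/-- This identifies `∑ binom(a, k) u^k` with `exp(a log(1+u))`: the logarithmic derivative is `a u /
(1+u)`, and the equation is checked after multiplying by `1 + u`. -/
theorem euler_binSeries (a : U) :
    euler (binSeries a) = newtonSeries (fun _ => a) * binSeries a := by
  have hn : (1 + PowerSeries.X) * newtonSeries (fun _ => a) = PowerSeries.X * C a := by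
    ext n
    rcases n with _ | _ | n
    · rw [coeff_zero_mul', coeff_newtonSeries_zero, coeff_zero_mul', coeff_zero_X]; simp
    · rw [add_mul, one_mul, map_add, coeff_succ_X_mul, coeff_succ_X_mul, coeff_newtonSeries_zero,
        coeff_newtonSeries _ (Nat.succ_ne_zero 0)]
      simp
    · rw [add_mul, one_mul, map_add, coeff_succ_X_mul, coeff_succ_X_mul,
        coeff_newtonSeries _ (Nat.succ_ne_zero _), coeff_newtonSeries _ (Nat.succ_ne_zero _),
        coeff_C_of_ne_zero (Nat.succ_ne_zero _)]
      simp [pow_succ]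
  refine one_add_X_mul_cancel ?_
  rw [← mul_assoc, hn]
  ext n
  rcases n with _ | n
  · rw [coeff_zero_mul', coeff_zero_mul', coeff_zero_mul', coeff_zero_X, coeff_euler]; simp
  · rw [add_mul, one_mul, map_add, coeff_succ_X_mul, mul_assoc, coeff_succ_X_mul, coeff_euler,
      coeff_euler, coeff_C_mul, coeff_binSeries, coeff_binSeries, nsmul_binom_succ]
    abel

/-- The coefficients of `(1 + w)^(2a) (1 - w)^(-4a)`. -/
theorem hat_theta_mem {a : U} {S : Subalgebra ℤ U} (h2 : ∀ k, binom ((2 : ℤ) • a) k ∈ S)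
    (h4 : ∀ k, binom ((-4 : ℤ) • a) k ∈ S) (k : ℕ) :
    hat (fun s : ℕ => (-1 : ℚ) ^ (s - 1) • ((4 : ℚ) + 2 * (-1) ^ (s - 1)) • a) k ∈ S := by
  have hY : hatSeries (fun s : ℕ => (-1 : ℚ) ^ (s - 1) • ((4 : ℚ) + 2 * (-1) ^ (s - 1)) • a) =
      binSeries ((2 : ℤ) • a) * altSeries (binSeries ((-4 : ℤ) • a)) := by
    refine hatSeries_eq_of_ode (fun r s => ?_) ?_ ?_
    · exact ((((Commute.refl a).smul_right _).smul_right _).smul_left _).smul_left _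
    · simp [coeff_zero_mul', coeff_altSeries]
    -- The logarithmic derivative splits as `2a w/(1+w) + 4a w/(1-w)`.
    · have hN : newtonSeries
          (fun s : ℕ => (-1 : ℚ) ^ (s - 1) • ((4 : ℚ) + 2 * (-1) ^ (s - 1)) • a) =
          newtonSeries (fun _ => (2 : ℤ) • a) + altSeries (newtonSeries fun _ => (-4 : ℤ) • a) := by
        ext s
        rw [map_add, coeff_altSeries]
        rcases s with _ | s
        · simp only [coeff_newtonSeries_zero]; simp
        · simp only [coeff_newtonSeries _ (Nat.succ_ne_zero s), Nat.succ_sub_one]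
          rcases Nat.even_or_odd s with h | h
          · rw [h.neg_one_pow, h.add_one.neg_one_pow]; module
          · rw [h.neg_one_pow, h.add_one.neg_one_pow]; module
      have hc : Commute (binSeries ((2 : ℤ) • a))
          (altSeries (newtonSeries fun _ => (-4 : ℤ) • a)) := by
        refine commute_of_coeff fun i j => ?_
        rw [coeff_altSeries]
        refine Commute.smul_right ?_ _
        rw [coeff_binSeries]
        refine commute_coeff_newtonSeries (fun _ => ?_) j
        have h : Commute ((-4 : ℤ) • a) ((2 : ℤ) • a) :=
          ((Commute.refl a).smul_right _).smul_left _
        exact (commute_binom h i).symm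
      rw [hN, euler_mul, euler_altSeries, euler_binSeries, euler_binSeries, altSeries_mul, add_mul,
        ← mul_assoc, ← mul_assoc, ← mul_assoc, hc.eq]
  rw [← coeff_hatSeries, hY, coeff_mul]
  refine S.sum_mem fun p _ => S.mul_mem ?_ ?_
  · rw [coeff_binSeries]; exact h2 _
  · rw [coeff_altSeries, coeff_binSeries]; exact S.zsmul_mem (h4 _) _

/-- Straightening in a Heisenberg algebra. -/
theorem hat_mul_hat_mem {p q κ : ℕ → U} (hp : ∀ r s, Commute (p r) (p s))
    (hq : ∀ r s, Commute (q r) (q s)) (hκ : ∀ r s, Commute (κ r) (κ s))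
    (hκp : ∀ r s, Commute (κ r) (p s)) (hκq : ∀ r s, Commute (κ r) (q s))
    (hpq : ∀ r s, r ≠ 0 → s ≠ 0 → p r * q s - q s * p r = if r = s then s • κ s else 0)
    (N : Submodule ℤ U)
    (hN : ∀ i j m, hat q i * hat (fun s : ℕ => (-1 : ℚ) ^ (s - 1) • κ s) j * hat p m ∈ N)
    (k l : ℕ) : hat p k * hat q l ∈ N := by
  -- The sign put in front of `κ s` cancels the one built into `newtonSeries`.
  have hK : ∀ s, s ≠ 0 →
      coeff s (newtonSeries fun s : ℕ => (-1 : ℚ) ^ (s - 1) • κ s) = κ s := by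
    intro s hs
    rw [coeff_newtonSeries _ hs, smul_smul, ← mul_pow]
    simp
  refine straighten_mem (e := hatSeries p) (F := hatSeries q) (P := newtonSeries q)
    (Θ := hatSeries fun s : ℕ => (-1 : ℚ) ^ (s - 1) • κ s)
    (euler_hatSeries hq) (coeff_zero_hatSeries q)
    (coeff_newtonSeries_zero q) (euler_hatSeries fun r s => ((hκ r s).smul_right _).smul_left _)
    (coeff_zero_hatSeries _) (coeff_newtonSeries_zero _) (fun i j => ?_) (fun s => ?_) N hN k l
  · refine commute_hat (fun s => ?_) j
    exact (commute_coeff_newtonSeries (fun r => ((hκq r s).smul_left _).symm) i).symm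
  · rcases eq_or_ne s 0 with rfl | hs
    · simp only [coeff_newtonSeries_zero]; simp
    rw [hK s hs]
    have hmono : Commute (newtonSeries p) (monomial s (κ s)) := by
      refine commute_of_coeff fun i j => ?_
      rw [coeff_monomial]
      split_ifs
      · exact (commute_coeff_newtonSeries (fun r => hκp s r) i).symm
      · exact Commute.zero_right _
    -- The weight `s` in `[p_s, q_s] = s κ_s` turns the commutator into the Euler derivative of `κ_s
    -- u^s`. Hence both sides of the conjugation formula solve the same equation.
    have hcom : newtonSeries p * C (coeff s (newtonSeries q)) =
        C (coeff s (newtonSeries q)) * newtonSeries p + s • monomial s (κ s) := by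
      ext r
      rw [coeff_mul_C, map_add, coeff_C_mul, map_nsmul, coeff_monomial]
      rcases eq_or_ne r 0 with rfl | hr
      · rw [coeff_newtonSeries_zero, if_neg hs.symm]; simp
      · have h := hpq r s hr hs
        rw [← sub_eq_iff_eq_add', coeff_newtonSeries _ hr, coeff_newtonSeries _ hs,
          smul_mul_smul_comm, smul_mul_smul_comm, mul_comm ((-1 : ℚ) ^ (s - 1)), ← smul_sub, h]
        split_ifs with hrs
        · rw [hrs, ← mul_pow]; simp
        · simp
    refine euler_ode_unique (L := newtonSeries p) (coeff_newtonSeries_zero p) ?_ ?_ ?_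
    · rw [euler_mul, euler_C, mul_zero, add_zero, euler_hatSeries hp, mul_assoc]
    · rw [euler_mul, map_add, euler_C, zero_add, euler_monomial, euler_hatSeries hp, ← mul_assoc,
        ← mul_assoc, mul_add, hcom, hmono.eq]
      noncomm_ring
    · rw [coeff_zero_mul', coeff_zero_mul', coeff_zero_hatSeries, map_add, coeff_zero_C,
        coeff_monomial, if_neg hs.symm]
      simp

theorem zBin_zSym_commute {ι : Type*} {x : ι → U} {p : ℕ → U} (h : ∀ i r, Commute (x i) (p r)) :
    ∀ a ∈ zBin x, ∀ b ∈ zSym p, a * b = b * a := by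
  refine adjoin_commute ?_
  rintro _ ⟨a, ha, k, rfl⟩ _ ⟨l, -, rfl⟩
  refine (commute_hat (fun r => (commute_binom ?_ k).symm) l).eq
  exact (span_commute (t := {p r}) (by rintro _ ⟨i, rfl⟩ _ rfl; exact h i r) ha
    (Submodule.mem_span_singleton_self _)).symm

theorem hat_mem_zSym (p : ℕ → U) (k : ℕ) : hat p k ∈ zSym p := by
  rcases Nat.eq_zero_or_pos k with rfl | hk
  · rw [← coeff_hatSeries, coeff_zero_hatSeries]; exact one_mem _
  · exact Algebra.subset_adjoin ⟨k, hk, rfl⟩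

theorem binom_mem_zBin {ι : Type*} (x : ι → U) {a : U}
    (ha : a ∈ Submodule.span ℤ (Set.range x)) (k : ℕ) : binom a k ∈ zBin x :=
  Algebra.subset_adjoin ⟨a, ha, k, rfl⟩

end Binomial

/-! ## The zero part -/

theorem com_h_h (r s : ℤ) : com (h r) (h s) =
    if r + s = 0 then (2 * (r : ℚ) * (2 + (-1 : ℚ) ^ (r - 1))) • c else 0 := by
  have := proj_comm (Rel.h_h r s)
  split_ifs at this ⊢ <;> simpa [h, c] using this

theorem commute_h_h {r s : ℤ} (hrs : r + s = 0 → r = 0) : Commute (h r) (h s) := by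
  refine com_eq_zero_iff.1 ?_
  rw [com_h_h]
  split_ifs with h0
  · rw [hrs h0]; simp
  · rfl

theorem commute_c_h (r : ℤ) : Commute c (h r) := com_eq_zero_iff.1 (lie_c_h r)

theorem commute_hh_hh {r s : ℤ} (hrs : r + s = 0 → r = 0) : Commute (hh r) (hh s) :=
  ((commute_h_h hrs).smul_left _).smul_right _

theorem commute_hh_unit (ε : ℤˣ) (r s : ℕ) :
    Commute (hh ((ε : ℤ) * (r : ℤ))) (hh ((ε : ℤ) * (s : ℤ))) := by
  refine commute_hh_hh fun h => ?_
  rcases Int.units_eq_one_or ε with rfl | rfl <;> simp at h ⊢ <;> omega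

theorem commute_cc_hh (r : ℤ) : Commute cc (hh r) :=
  ((commute_c_h r).smul_left _).smul_right _

theorem commute_cartan_hh (i : Fin 2) (r : ℤ) :
    Commute ((![(2 : ℚ) • hh 0, cc - hh 0] : Fin 2 → Env) i) (hh r) := by
  have h0 : Commute (hh 0) (hh r) := commute_hh_hh fun _ => rfl
  fin_cases i
  · exact h0.smul_left _
  · exact (commute_cc_hh r).sub_left h0

theorem h_eq_smul_hh (r : ℤ) : h r = (2 : ℚ) • hh r := by
  rw [hh, smul_smul]; norm_num

theorem c_eq_smul_cc : c = (4 : ℚ) • cc := by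
  rw [cc, smul_smul]; norm_num

theorem zBin_h_c_eq : zBin ![h 0, c] = zBin ![(2 : ℚ) • hh 0, (4 : ℚ) • cc] := by
  rw [← h_eq_smul_hh, ← c_eq_smul_cc]

theorem smul_hh_mem_span : (2 : ℚ) • hh 0 ∈
    Submodule.span ℤ (Set.range ![(2 : ℚ) • hh 0, cc - hh 0]) :=
  Submodule.subset_span ⟨0, rfl⟩

/-- Although `c̃` itself need not be available, `2c̃ = 2(c̃ - 𝔥_0) + 2𝔥_0` is. This covers `c = 4c̃`
and the exponents `2c̃`, `-4c̃` produced by straightening. -/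
theorem even_cc_mem_span (n : ℤ) : (2 * n) • cc ∈
    Submodule.span ℤ (Set.range ![(2 : ℚ) • hh 0, cc - hh 0]) := by
  have : (2 * n) • cc = (2 * n) • (cc - hh 0) + n • (2 : ℚ) • hh 0 := by module
  rw [this]
  exact add_mem (Submodule.smul_mem _ _ (Submodule.subset_span ⟨1, rfl⟩))
    (Submodule.smul_mem _ _ smul_hh_mem_span)

theorem zBin_le : zBin ![(2 : ℚ) • hh 0, (4 : ℚ) • cc] ≤ zBin ![(2 : ℚ) • hh 0, cc - hh 0] := by
  have h : Submodule.span ℤ (Set.range ![(2 : ℚ) • hh 0, (4 : ℚ) • cc]) ≤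
      Submodule.span ℤ (Set.range ![(2 : ℚ) • hh 0, cc - hh 0]) := by
    refine Submodule.span_le.2 ?_
    rintro _ ⟨i, rfl⟩
    fin_cases i
    · exact smul_hh_mem_span
    · have : (4 : ℚ) • cc = (2 * 2 : ℤ) • cc := by module
      change (4 : ℚ) • cc ∈ _
      rw [this]; exact even_cc_mem_span 2
  refine Algebra.adjoin_mono ?_
  rintro _ ⟨a, ha, k, rfl⟩
  exact ⟨a, h ha, k, rfl⟩

theorem drinfeldIm_le_mitzmanIm (ε : ℤˣ) : drinfeldIm ε ≤ mitzmanIm ε := by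
  have := zSym_eps_le (p := fun r : ℕ => hh ((ε : ℤ) * (r : ℤ))) (commute_hh_unit ε)
  simp only [← h_eq_smul_hh] at this
  exact this

/-- Rescaling the defining relation gives `[𝔥_r, 𝔥_{-r}] = r (4 + 2(-1)^(r-1)) c̃`, so the
correction factor is `(1+w)^(2c̃) (1-w)^(-4c̃)`, with coefficients in the Mitzman Cartan part. -/
theorem hat_pos_mul_hat_neg_mem (k l : ℕ) :
    hat (fun r : ℕ => hh (((1 : ℤˣ) : ℤ) * (r : ℤ))) k *
      hat (fun r : ℕ => hh (((-1 : ℤˣ) : ℤ) * (r : ℤ))) l ∈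
    (mitzmanIm (-1)).toSubmodule * mitzmanCartan.toSubmodule *
      Submodule.span ℤ (Set.range fun k => hat (fun r : ℕ => hh (((1 : ℤˣ) : ℤ) * (r : ℤ))) k) := by
  refine hat_mul_hat_mem (κ := fun s : ℕ => ((4 : ℚ) + 2 * (-1) ^ (s - 1)) • cc)
    (commute_hh_unit 1) (commute_hh_unit (-1))
    (fun r s => ((Commute.refl cc).smul_right _).smul_left _)
    (fun r s => (commute_cc_hh _).smul_left _) (fun r s => (commute_cc_hh _).smul_left _)
    (fun r s hr hs => ?_) _ (fun i j m => ?_) k l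
  · change com (hh _) (hh _) = _
    rw [hh, hh, com_smul, smul_com, com_h_h]
    by_cases hrs : r = s
    · subst hrs
      obtain ⟨r, rfl⟩ := Nat.exists_eq_succ_of_ne_zero hr
      have e : (-1 : ℚ) ^ ((((1 : ℤˣ) : ℤ) * ((r.succ : ℕ) : ℤ)) - 1) = (-1) ^ r := by
        rw [← zpow_natCast]; congr 1; push_cast; ring
      rw [if_pos (by simp), if_pos rfl, e, c_eq_smul_cc, Nat.succ_sub_one]
      push_cast
      module
    · rw [if_neg (by simp; omega), if_neg hrs]; simp
  · refine Submodule.mul_mem_mul (Submodule.mul_mem_mul (hat_mem_zSym _ _) ?_)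
      (Submodule.subset_span ⟨m, rfl⟩)
    exact hat_theta_mem (S := mitzmanCartan)
      (fun k => binom_mem_zBin _ (by simpa using even_cc_mem_span 1) k)
      (fun k => binom_mem_zBin _ (by simpa using even_cc_mem_span (-2)) k) j

/-- The three Drinfeld factors lie in the three Mitzman factors, so it is enough that the product of
the latter is stable under left multiplication by each of them. -/
theorem drinfeldZero_le_mitzmanZero : drinfeldZero.toSubmodule ≤ mitzmanZero := by
  have hneg : ∀ a ∈ mitzmanIm (-1), ∀ b ∈ mitzmanCartan, a * b = b * a := fun a ha b hb =>
    (zBin_zSym_commute (fun i r => commute_cartan_hh i _) b hb a ha).symm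
  have hpos : ∀ a ∈ mitzmanIm 1, ∀ b ∈ mitzmanCartan, a * b = b * a := fun a ha b hb =>
    (zBin_zSym_commute (fun i r => commute_cartan_hh i _) b hb a ha).symm
  have hEC : (mitzmanIm (-1)).toSubmodule * mitzmanCartan.toSubmodule =
      mitzmanCartan.toSubmodule * (mitzmanIm (-1)).toSubmodule := submodule_mul_comm hneg
  have hCC := subalgebra_mul_self mitzmanCartan
  have hEE := subalgebra_mul_self (mitzmanIm (-1))
  have hle : drinfeldZero ≤ mitzmanIm (-1) ⊔ mitzmanCartan ⊔ mitzmanIm 1 := by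
    refine sup_le_sup (sup_le_sup (drinfeldIm_le_mitzmanIm _) ?_) (drinfeldIm_le_mitzmanIm _)
    exact zBin_h_c_eq.le.trans zBin_le
  refine le_trans (Subalgebra.toSubmodule.monotone hle) ?_
  -- The positive factor enters through its generators `p̂_k` alone, since these are the elements
  -- for which the crossing formula is known.
  have hadj : mitzmanIm (-1) ⊔ mitzmanCartan ⊔ mitzmanIm 1 =
      Algebra.adjoin ℤ ((mitzmanIm (-1) : Set Env) ∪ mitzmanCartan ∪
        {b | ∃ k : ℕ, 0 < k ∧ b = hat (fun r : ℕ => hh (((1 : ℤˣ) : ℤ) * (r : ℤ))) k}) := by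
    rw [Algebra.adjoin_union, Algebra.adjoin_union, Algebra.adjoin_eq, Algebra.adjoin_eq]
    rfl
  rw [hadj]
  refine adjoin_le_submodule ?_ ?_
  · have := Submodule.mul_mem_mul (Submodule.mul_mem_mul (M := (mitzmanIm (-1)).toSubmodule)
      (N := mitzmanCartan.toSubmodule) (one_mem (mitzmanIm (-1))) (one_mem mitzmanCartan)) (N := (mitzmanIm 1).toSubmodule)
      (one_mem (mitzmanIm 1))
    rw [mul_one, mul_one] at this
    exact this
  rintro a ((ha | ha) | ⟨k, -, rfl⟩) n hn
  · have h2 := Submodule.mul_mem_mul (M := (mitzmanIm (-1)).toSubmodule) ha hn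
    rw [mitzmanZero, ← mul_assoc, ← mul_assoc, hEE] at h2
    exact h2
  · have h2 := Submodule.mul_mem_mul (M := mitzmanCartan.toSubmodule) ha hn
    rw [mitzmanZero, ← mul_assoc, hEC, ← mul_assoc, hCC, ← hEC] at h2
    exact h2
  · have hBO : Submodule.span ℤ (Set.range fun k =>
        hat (fun r : ℕ => hh (((1 : ℤˣ) : ℤ) * (r : ℤ))) k) ≤ (mitzmanIm 1).toSubmodule :=
      Submodule.span_le.2 <| by rintro _ ⟨k, rfl⟩; exact hat_mem_zSym _ k
    refine mul_triple_le (Y := mitzmanCartan) (O := mitzmanIm 1)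
      (fun a ha b hb => hneg a (Algebra.subset_adjoin ha) b hb) ?_ hBO
      (fun b hb z hz => hpos b (hBO hb) z hz)
      (Submodule.mul_mem_mul (Submodule.subset_span ⟨k, rfl⟩) hn)
    rintro _ ⟨l, -, rfl⟩ b hb
    induction hb using Submodule.span_induction with
    | mem b hb =>
      obtain ⟨k, rfl⟩ := hb
      exact hat_pos_mul_hat_neg_mem k l
    | zero => rw [zero_mul]; exact zero_mem _
    | add b b' _ _ h h' => rw [add_mul]; exact add_mem h h'
    | smul n b _ h => rw [smul_mul_assoc]; exact Submodule.smul_mem _ _ h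

/-! ## Level zero representations -/

section Representation

/-- The matrix of `h_r`, for `a = i^r` and `σ = (-1)^r`. -/
def hMat (a σ : ℂ) : Matrix (Fin 3) (Fin 3) ℂ :=
  Matrix.diagonal ![a * 2, a * (2 * σ - 2), a * (-2 * σ)]

/-- The matrix of `x_r^ε`, for `a = i^r` and `σ = (-1)^r`. -/
def xMat (ε : ℤˣ) (a σ : ℂ) : Matrix (Fin 3) (Fin 3) ℂ :=
  if ε = 1 then !![0, a * 2, 0; 0, 0, a * σ; 0, 0, 0] else !![0, 0, 0; a, 0, 0; 0, a * (2 * σ), 0]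

/-- The matrix of `X_r^ε`, for `a = 4 i^r`. -/
def XMat (ε : ℤˣ) (a : ℂ) : Matrix (Fin 3) (Fin 3) ℂ :=
  if ε = 1 then !![0, 0, a; 0, 0, 0; 0, 0, 0] else !![0, 0, 0; 0, 0, 0; a, 0, 0]

/-- The natural representation of the twisted loop algebra, evaluated at `t = i`. -/
def genMat : Gen → Matrix (Fin 3) (Fin 3) ℂ
  | Gen.c => 0
  | Gen.h r => hMat (Complex.I ^ r) ((-1) ^ r)
  | Gen.x ε r => xMat ε (Complex.I ^ r) ((-1) ^ r)
  | Gen.X ε k => XMat ε (4 * Complex.I ^ (2 * k + 1))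

variable {a b σ τ : ℂ}

theorem hMat_bracket_hMat : hMat a σ * hMat b τ - hMat b τ * hMat a σ = 0 := by
  rw [hMat, hMat, Matrix.diagonal_mul_diagonal, Matrix.diagonal_mul_diagonal, sub_eq_zero]
  congr 1; ext i; ring

theorem hMat_bracket_xMat (ε : ℤˣ) (hσ : σ = 1 ∨ σ = -1) :
    hMat a σ * xMat ε b τ - xMat ε b τ * hMat a σ =
      ((ε : ℤ) * 2 * (2 - σ) : ℂ) • xMat ε (a * b) (σ * τ) := by
  rcases Int.units_eq_one_or ε with rfl | rfl <;> rcases hσ with rfl | rfl <;> ext i j <;>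
    rw [hMat, Matrix.sub_apply, Matrix.diagonal_mul, Matrix.mul_diagonal] <;>
    fin_cases i <;> fin_cases j <;> simp [xMat] <;> ring

theorem hMat_bracket_XMat (ε : ℤˣ) (hσ : σ = 1 ∨ σ = -1) :
    hMat a σ * XMat ε b - XMat ε b * hMat a σ =
      ((ε : ℤ) * 2 * (1 + σ) : ℂ) • XMat ε (a * b) := by
  rcases Int.units_eq_one_or ε with rfl | rfl <;> rcases hσ with rfl | rfl <;> ext i j <;>
    rw [hMat, Matrix.sub_apply, Matrix.diagonal_mul, Matrix.mul_diagonal] <;>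
    fin_cases i <;> fin_cases j <;> simp [XMat] <;> ring

theorem xMat_bracket_xMat (ε : ℤˣ) :
    xMat ε a σ * xMat ε b τ - xMat ε b τ * xMat ε a σ =
      ((ε : ℤ) * (τ - σ) : ℂ) • XMat ε (2 * (a * b)) := by
  rcases Int.units_eq_one_or ε with rfl | rfl <;> ext i j <;>
    fin_cases i <;> fin_cases j <;> simp [xMat, XMat] <;> ring

theorem xMat_bracket_XMat (ε : ℤˣ) : xMat ε a σ * XMat ε b - XMat ε b * xMat ε a σ = 0 := by
  rcases Int.units_eq_one_or ε with rfl | rfl <;> ext i j <;>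
    fin_cases i <;> fin_cases j <;> simp [xMat, XMat]

theorem XMat_mul_XMat (ε : ℤˣ) : XMat ε a * XMat ε b = 0 := by
  rcases Int.units_eq_one_or ε with rfl | rfl <;> ext i j <;>
    fin_cases i <;> fin_cases j <;> simp [XMat, Matrix.mul_apply, Fin.sum_univ_three]

theorem xMat_bracket_xMat_neg (hσ : σ = 1 ∨ σ = -1) (hτ : τ = 1 ∨ τ = -1) :
    xMat 1 a σ * xMat (-1) b τ - xMat (-1) b τ * xMat 1 a σ = hMat (a * b) (σ * τ) := by
  rcases hσ with rfl | rfl <;> rcases hτ with rfl | rfl <;> ext i j <;>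
    fin_cases i <;> fin_cases j <;>
    simp [xMat, hMat] <;> ring

theorem xMat_bracket_XMat_neg (ε : ℤˣ) (hσ : σ = 1 ∨ σ = -1) :
    xMat ε a σ * XMat (-ε) (4 * b) - XMat (-ε) (4 * b) * xMat ε a σ =
      ((ε : ℤ) * σ * 4 : ℂ) • xMat (-ε) (a * b) (-σ) := by
  rcases Int.units_eq_one_or ε with rfl | rfl <;> rcases hσ with rfl | rfl <;> ext i j <;>
    fin_cases i <;> fin_cases j <;>
    simp [xMat, XMat] <;> ring

theorem XMat_bracket_XMat_neg :
    XMat 1 (4 * a) * XMat (-1) (4 * b) - XMat (-1) (4 * b) * XMat 1 (4 * a) =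
      (8 : ℂ) • hMat (a * b) 1 := by
  ext i j
  fin_cases i <;> fin_cases j <;>
    simp [XMat, hMat] <;> ring

theorem neg_one_zpow_cases {K : Type*} [DivisionRing K] (r : ℤ) :
    (-1 : K) ^ r = 1 ∨ (-1 : K) ^ r = -1 := by
  rcases Int.even_or_odd r with h | h
  · exact Or.inl h.neg_one_zpow
  · exact Or.inr h.neg_one_zpow

variable {A : Type*} [Ring A] [Algebra ℚ A]

/-- The free version of the representation of `Ũ` attached to a representation of `𝔤𝔩₃`. -/
def freeRep (Φ : Matrix (Fin 3) (Fin 3) ℂ →+ A) : Free →ₐ[ℚ] A :=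
  FreeAlgebra.lift ℚ fun g => Φ (genMat g)

theorem freeRep_ι (Φ : Matrix (Fin 3) (Fin 3) ℂ →+ A) (g : Gen) :
    freeRep Φ (FreeAlgebra.ι ℚ g) = Φ (genMat g) := FreeAlgebra.lift_ι_apply _ _

theorem ratCast_smul_mat (q : ℚ) (M : Matrix (Fin 3) (Fin 3) ℂ) : (q : ℂ) • M = q • M := by
  ext i j; simp [Rat.smul_def]

/-- Every relation prescribes a commutator and `c` acts by zero, so an additive map respecting
commutators suffices. The natural representation and the one by differential operators thus share
one verification. -/
theorem freeRep_rel {Φ : Matrix (Fin 3) (Fin 3) ℂ →+ A}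
    (hΦ : ∀ M N, Φ (M * N - N * M) = Φ M * Φ N - Φ N * Φ M) {u v : Free} (huv : Rel u v) :
    freeRep Φ u = freeRep Φ v := by
  have hcomm : ∀ g g' : Gen, freeRep Φ (Free.comm (FreeAlgebra.ι ℚ g) (FreeAlgebra.ι ℚ g')) =
      Φ (genMat g * genMat g' - genMat g' * genMat g) := by
    intro g g'
    rw [Free.comm, map_sub, map_mul, map_mul, freeRep_ι, freeRep_ι, hΦ]
  have hsmul : ∀ (q : ℚ) (g : Gen), freeRep Φ (q • FreeAlgebra.ι ℚ g) = Φ ((q : ℂ) • genMat g) := by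
    intro q g
    rw [map_smul, freeRep_ι, ratCast_smul_mat, map_rat_smul]
  have hc0 : ∀ (p : Prop) [Decidable p] (q : ℚ),
      freeRep Φ (if p then q • Free.c else 0) = 0 := by
    intro p _ q
    split_ifs
    · rw [Free.c, hsmul]; simp [genMat]
    · exact map_zero _
  have hI := Complex.I_ne_zero
  have hm : (-1 : ℂ) ≠ 0 := by norm_num
  have hsgn : ∀ ε : ℤˣ, ((Free.sgn ε : ℚ) : ℂ) = ((ε : ℤ) : ℂ) := fun ε => by simp [Free.sgn]
  cases huv with
  | c_central g => rw [Free.c, hcomm]; simp [genMat]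
  | h_h r s => rw [Free.h, Free.h, hcomm, hc0]; simp only [genMat]; rw [hMat_bracket_hMat, map_zero]
  | h_x ε r s =>
    rw [Free.h, Free.x, Free.x, hcomm, hsmul]
    simp only [genMat]
    rw [hMat_bracket_xMat ε (neg_one_zpow_cases r), ← zpow_add₀ hI, ← zpow_add₀ hm]
    push_cast
    rw [hsgn, zpow_sub_one₀ hm]
    congr 2; norm_num; ring
  | h_X_even ε r k =>
    rw [Free.h, Free.X, Free.X, hcomm, hsmul]
    simp only [genMat]
    rw [hMat_bracket_XMat ε (neg_one_zpow_cases _), (even_two_mul r).neg_one_zpow]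
    push_cast
    rw [hsgn, mul_left_comm, ← zpow_add₀ hI]
    have e : 2 * r + (2 * k + 1) = 2 * (r + k) + 1 := by ring
    rw [e]
    congr 2; ring
  | h_X_odd ε r k =>
    rw [Free.h, Free.X, hcomm]
    simp only [genMat]
    rw [hMat_bracket_XMat ε (neg_one_zpow_cases _), (odd_two_mul_add_one r).neg_one_zpow]
    simp
  | x_x_even ε r s hrs =>
    rw [Free.x, Free.x, hcomm]
    simp only [genMat]
    have : (-1 : ℂ) ^ s = (-1) ^ r := by
      rcases Int.even_or_odd r with h | h
      · rw [h.neg_one_zpow, ((Int.even_add.1 hrs).1 h).neg_one_zpow]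
      · have h' : Odd s := by
          rw [← Int.not_even_iff_odd] at h ⊢; exact fun hs => h ((Int.even_add.1 hrs).2 hs)
        rw [h.neg_one_zpow, h'.neg_one_zpow]
    rw [xMat_bracket_xMat, this]
    simp
  | x_x_odd ε r s k hrs =>
    rw [Free.x, Free.x, Free.X, hcomm, hsmul]
    simp only [genMat]
    have : (-1 : ℂ) ^ r = -(-1) ^ s := by
      have h : r = (2 * k + 1) - s := by omega
      rw [h, zpow_sub₀ hm, (odd_two_mul_add_one k).neg_one_zpow]
      rcases neg_one_zpow_cases (K := ℂ) s with e | e <;> rw [e] <;> norm_num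
    rw [xMat_bracket_xMat, this, ← hrs, zpow_add₀ hI]
    push_cast
    rw [hsgn]
    congr 1
    rcases Int.units_eq_one_or ε with rfl | rfl <;> ext i j <;>
      fin_cases i <;> fin_cases j <;> simp [XMat] <;> ring
  | x_X ε r k => rw [Free.x, Free.X, hcomm]; simp only [genMat]; rw [xMat_bracket_XMat]; simp
  | X_X ε k l => rw [Free.X, Free.X, hcomm]; simp only [genMat]; simp [XMat_mul_XMat]
  | x_x_opp r s =>
    rw [Free.x, Free.x, hcomm, map_add, hc0, add_zero, Free.h, freeRep_ι]
    simp only [genMat]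
    rw [xMat_bracket_xMat_neg (neg_one_zpow_cases _) (neg_one_zpow_cases _), zpow_add₀ hI,
      zpow_add₀ hm]
  | x_X_opp ε r k =>
    rw [Free.x, Free.X, Free.x, hcomm, hsmul]
    simp only [genMat]
    rw [xMat_bracket_XMat_neg ε (neg_one_zpow_cases _), ← zpow_add₀ hI, zpow_add₀ hm,
      (odd_two_mul_add_one k).neg_one_zpow, mul_neg_one]
    push_cast
    rw [hsgn]
  | X_X_opp k l =>
    rw [Free.X, Free.X, hcomm, map_add, hc0, add_zero, Free.h, hsmul]
    simp only [genMat]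
    rw [XMat_bracket_XMat_neg, ← zpow_add₀ hI,
      ((odd_two_mul_add_one k).add_odd (odd_two_mul_add_one l)).neg_one_zpow]
    norm_num

/-- The representation of `Ũ` attached to a representation of `𝔤𝔩₃`. -/
def rep (Φ : Matrix (Fin 3) (Fin 3) ℂ →+ A)
    (hΦ : ∀ M N, Φ (M * N - N * M) = Φ M * Φ N - Φ N * Φ M) : Env →ₐ[ℚ] A :=
  RingQuot.liftAlgHom ℚ ⟨freeRep Φ, fun _ _ huv => freeRep_rel hΦ huv⟩

theorem rep_proj (Φ : Matrix (Fin 3) (Fin 3) ℂ →+ A)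
    (hΦ : ∀ M N, Φ (M * N - N * M) = Φ M * Φ N - Φ N * Φ M) (g : Gen) :
    rep Φ hΦ (proj (FreeAlgebra.ι ℚ g)) = Φ (genMat g) := by
  rw [← freeRep_ι]
  exact RingQuot.liftAlgHom_mkAlgHom_apply ℚ _ _ _

end Representation

/-! ## A lattice separating the two integral forms -/

section Lattice

/-- The group `mℤ + nℤ i`. -/
def gaussGroup (m n : ℤ) : AddSubgroup ℂ where
  carrier := {z | ∃ p q : ℤ, z = ((m * p : ℤ) : ℂ) + ((n * q : ℤ) : ℂ) * Complex.I}
  zero_mem' := ⟨0, 0, by simp⟩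
  add_mem' := by
    rintro _ _ ⟨p, q, rfl⟩ ⟨p', q', rfl⟩
    exact ⟨p + p', q + q', by push_cast; ring⟩
  neg_mem' := by
    rintro _ ⟨p, q, rfl⟩
    exact ⟨-p, -q, by push_cast; ring⟩

theorem gaussGroup_mul_mem {m n m' n' k l : ℤ} (h1 : k ∣ m * m') (h2 : k ∣ n * n')
    (h3 : l ∣ m * n') (h4 : l ∣ n * m') {z w : ℂ} (hz : z ∈ gaussGroup m n)
    (hw : w ∈ gaussGroup m' n') : z * w ∈ gaussGroup k l := by
  obtain ⟨p, q, rfl⟩ := hz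
  obtain ⟨p', q', rfl⟩ := hw
  obtain ⟨a, ha⟩ := h1
  obtain ⟨b, hb⟩ := h2
  obtain ⟨c, hc⟩ := h3
  obtain ⟨d, hd⟩ := h4
  refine ⟨a * p * p' - b * q * q', c * p * q' + d * q * p', ?_⟩
  have e1 : k * (a * p * p' - b * q * q') = m * m' * p * p' - n * n' * q * q' := by
    rw [ha, hb]; ring
  have e2 : l * (c * p * q' + d * q * p') = m * n' * p * q' + n * m' * q * p' := by
    rw [hc, hd]; ring
  rw [e1, e2]
  push_cast
  linear_combination ((n : ℂ) * n' * q * q') * Complex.I_sq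

theorem I_mem_gaussGroup_iff {n : ℤ} : Complex.I ∈ gaussGroup 1 n ↔ n ∣ 1 := by
  constructor
  · rintro ⟨p, q, h⟩
    have := congrArg Complex.im h
    simp at this
    exact ⟨q, by exact_mod_cast this⟩
  · rintro ⟨q, h⟩
    exact ⟨0, q, by rw [← h]; simp⟩

/-- The order `ℤ + 2ℤ i`. -/
def gaussOrder : Subring ℂ where
  __ := gaussGroup 1 2
  one_mem' := ⟨1, 0, by simp⟩
  mul_mem' := fun hz hw => gaussGroup_mul_mem (by decide) (by decide) (by decide) (by decide) hz hw

theorem mem_gaussOrder {z : ℂ} : z ∈ gaussOrder ↔ z ∈ gaussGroup 1 2 := Iff.rfl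

theorem I_zpow_mem (r : ℤ) : Complex.I ^ r ∈ gaussGroup 1 1 := by
  have hI : Complex.I ∈ gaussGroup 1 1 := I_mem_gaussGroup_iff.2 (by decide)
  induction r using Int.induction_on with
  | zero => exact ⟨1, 0, by simp⟩
  | succ r ih =>
    rw [zpow_add_one₀ Complex.I_ne_zero]
    exact gaussGroup_mul_mem (by decide) (by decide) (by decide) (by decide) ih hI
  | pred r ih =>
    rw [zpow_sub_one₀ Complex.I_ne_zero, Complex.inv_I]
    exact gaussGroup_mul_mem (by decide) (by decide) (by decide) (by decide) ih (neg_mem hI)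

/-- The real parts allowed in `latticeRing`. -/
def patRe : Matrix (Fin 3) (Fin 3) ℤ := !![1, 2, 1; 1, 1, 1; 1, 2, 1]

/-- The imaginary parts allowed in `latticeRing`. -/
def patIm : Matrix (Fin 3) (Fin 3) ℤ := !![2, 2, 2; 1, 1, 1; 2, 2, 2]

/-- An order of `M₃(ℤ[i])` containing the image of the Drinfeld form. -/
def latticeRing : Subring (Matrix (Fin 3) (Fin 3) ℂ) where
  carrier := {M | ∀ i j, M i j ∈ gaussGroup (patRe i j) (patIm i j)}
  zero_mem' := fun i j => zero_mem _
  one_mem' := by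
    intro i j
    rw [Matrix.one_apply]
    split_ifs with h
    · subst h
      exact ⟨1, 0, by fin_cases i <;> simp [patRe]⟩
    · exact zero_mem _
  add_mem' := fun hM hN i j => add_mem (hM i j) (hN i j)
  neg_mem' := fun hM i j => neg_mem (hM i j)
  mul_mem' := by
    intro M N hM hN i j
    rw [Matrix.mul_apply]
    refine sum_mem fun k _ => ?_
    have h : ∀ i j k : Fin 3, patRe i j ∣ patRe i k * patRe k j ∧
        patRe i j ∣ patIm i k * patIm k j ∧ patIm i j ∣ patRe i k * patIm k j ∧
        patIm i j ∣ patIm i k * patRe k j := by decide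
    obtain ⟨h1, h2, h3, h4⟩ := h i j k
    exact gaussGroup_mul_mem h1 h2 h3 h4 (hM i k) (hN k j)

/-- At `a = i^r`, `σ = (-1)^r` the corner entry `a² σ` equals `1` for every `r`. This is why
evaluation at `t = i` separates the forms. -/
theorem xMat_sq (ε : ℤˣ) (a σ : ℂ) : xMat ε a σ ^ 2 = (2 : ℚ) • XMat ε (a ^ 2 * σ) := by
  rw [pow_two, ← ratCast_smul_mat]
  rcases Int.units_eq_one_or ε with rfl | rfl <;> ext i j <;>
    fin_cases i <;> fin_cases j <;> simp [xMat, XMat] <;> ring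

theorem xMat_cube (ε : ℤˣ) (a σ : ℂ) : xMat ε a σ ^ 3 = 0 := by
  rw [pow_succ, xMat_sq, smul_mul_assoc, smul_eq_zero]
  right
  rcases Int.units_eq_one_or ε with rfl | rfl <;> ext i j <;>
    fin_cases i <;> fin_cases j <;> simp [xMat, XMat]

theorem XMat_mem_iff {ε : ℤˣ} {a : ℂ} : XMat ε a ∈ latticeRing ↔ a ∈ gaussOrder := by
  constructor
  · intro h
    rcases Int.units_eq_one_or ε with rfl | rfl
    · simpa [XMat, patRe, patIm, mem_gaussOrder] using h 0 2
    · simpa [XMat, patRe, patIm, mem_gaussOrder] using h 2 0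
  · intro h i j
    have h0 := fun m n => zero_mem (gaussGroup m n)
    rw [mem_gaussOrder] at h
    rcases Int.units_eq_one_or ε with rfl | rfl <;> fin_cases i <;> fin_cases j <;>
      simp [XMat, patRe, patIm, h, h0]

theorem divPow_eq_zero {U : Type*} [Ring U] [Algebra ℚ U] {a : U} {n k : ℕ} (ha : a ^ n = 0)
    (hk : n ≤ k) : divPow a k = 0 := by
  rw [divPow, pow_eq_zero_of_le hk ha, smul_zero]

theorem xMat_mem (ε : ℤˣ) (r : ℤ) : xMat ε (Complex.I ^ r) ((-1) ^ r) ∈ latticeRing := by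
  have h0 := fun m n => zero_mem (gaussGroup m n)
  have h1 := I_zpow_mem r
  have h2 : Complex.I ^ r * 2 ∈ gaussGroup 2 2 :=
    gaussGroup_mul_mem (m' := 2) (n' := 2) (by decide) (by decide) (by decide) (by decide) h1
      ⟨1, 0, by simp⟩
  intro i j
  rcases Int.units_eq_one_or ε with rfl | rfl <;>
    rcases neg_one_zpow_cases (K := ℂ) r with e | e <;> rw [e] <;> fin_cases i <;> fin_cases j <;>
    simp [xMat, patRe, patIm, h0, h1, h2]

/-- Only the divided square could spoil the corner condition `ℤ + 2ℤi`, and its corner entry is `1`;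
the cube vanishes. -/
theorem divPow_xMat_mem (ε : ℤˣ) (r : ℤ) (k : ℕ) :
    divPow (xMat ε (Complex.I ^ r) ((-1) ^ r)) k ∈ latticeRing := by
  rcases k with _ | _ | _ | k
  · rw [divPow_zero]; exact one_mem _
  · rw [divPow_one]; exact xMat_mem ε r
  · have h1 : (Complex.I ^ r) ^ 2 * (-1) ^ r = 1 := by
      rw [← zpow_natCast, zpow_comm, zpow_natCast, Complex.I_sq]
      rcases neg_one_zpow_cases (K := ℂ) r with e | e <;> rw [e] <;> norm_num
    rw [divPow, xMat_sq, smul_smul, h1]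
    norm_num [XMat_mem_iff, one_mem]
  · rw [divPow_eq_zero (xMat_cube _ _ _) (by omega)]; exact zero_mem _

/-- The natural representation of `Ũ`. -/
def natRep : Env →ₐ[ℚ] Matrix (Fin 3) (Fin 3) ℂ := rep (AddMonoidHom.id _) fun _ _ => rfl

theorem natRep_x (ε : ℤˣ) (r : ℤ) : natRep (x ε r) = xMat ε (Complex.I ^ r) ((-1) ^ r) :=
  rep_proj _ _ (Gen.x ε r)

theorem natRep_X (ε : ℤˣ) (k : ℤ) : natRep (X ε k) = XMat ε (4 * Complex.I ^ (2 * k + 1)) :=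
  rep_proj _ _ (Gen.X ε k)

theorem natRep_h (r : ℤ) : natRep (h r) = hMat (Complex.I ^ r) ((-1) ^ r) :=
  rep_proj _ _ (Gen.h r)

theorem natRep_c : natRep c = 0 := rep_proj _ _ Gen.c

theorem smul_XMat (q : ℚ) (ε : ℤˣ) (a : ℂ) : q • XMat ε a = XMat ε (q * a) := by
  rw [← ratCast_smul_mat]
  rcases Int.units_eq_one_or ε with rfl | rfl <;> ext i j <;>
    fin_cases i <;> fin_cases j <;> simp [XMat]

theorem XMat_add (ε : ℤˣ) (a b : ℂ) : XMat ε a + XMat ε b = XMat ε (a + b) := by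
  rcases Int.units_eq_one_or ε with rfl | rfl <;> ext i j <;>
    fin_cases i <;> fin_cases j <;> simp [XMat]

/-- The corner entry of `y_1^±` is `i`, which is not in `ℤ + 2ℤi`. -/
theorem natRep_y_zero_not_mem (ε : ℤˣ) : natRep (y ε 0) ∉ latticeRing := by
  rw [y, map_smul, natRep_X, smul_XMat, XMat_mem_iff]
  have : ((1 / 4 : ℚ) : ℂ) * (4 * Complex.I ^ (2 * (0 : ℤ) + 1)) = Complex.I := by
    norm_num; ring
  rw [this, mem_gaussOrder, I_mem_gaussGroup_iff]
  decide

/-- The separation principle: a subring that contains the images of the generators contains the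
image of the whole integral form. -/
theorem adjoin_le_comap {A : Type*} [Ring A] [Algebra ℚ A] (φ : Env →ₐ[ℚ] A) (R : Subring A)
    {s : Set Env} (hs : ∀ b ∈ s, φ b ∈ R) {b : Env} (hb : b ∈ Algebra.adjoin ℤ s) : φ b ∈ R := by
  have : Algebra.adjoin ℤ s ≤ subalgebraOfSubring (R.comap (φ : Env →+* A)) :=
    Algebra.adjoin_le hs
  exact this hb

theorem natRep_mem_of_mem_drinfeldForm {b : Env} (hb : b ∈ drinfeldForm) :
    natRep b ∈ latticeRing := by
  refine adjoin_le_comap natRep latticeRing ?_ hb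
  rintro _ ⟨ε, r, k, rfl⟩
  rw [map_divPow, natRep_x]
  exact divPow_xMat_mem ε r k

/-- The corner entries lie in `4ℤ[i] ⊆ ℤ + 2ℤi`, and these matrices square to zero, so no
denominators arise. -/
theorem natRep_mem_of_mem_zDiv {ε : ℤˣ} {b : Env} (hb : b ∈ zDiv fun r : ℤ => X ε r) :
    natRep b ∈ latticeRing := by
  refine adjoin_le_comap natRep latticeRing ?_ hb
  rintro _ ⟨a, ha, k, rfl⟩
  have hX : ∃ z ∈ gaussOrder, natRep a = XMat ε z := by
    induction ha using Submodule.span_induction with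
    | mem a ha =>
      obtain ⟨r, rfl⟩ := ha
      refine ⟨_, ?_, natRep_X ε r⟩
      exact gaussGroup_mul_mem (m := 4) (n := 4) (by decide) (by decide) (by decide) (by decide)
        ⟨1, 0, by simp⟩ (I_zpow_mem _)
    | zero =>
      refine ⟨0, zero_mem _, ?_⟩
      rw [map_zero]
      simpa using (smul_XMat 0 ε 0)
    | add a b _ _ iha ihb =>
      obtain ⟨z, hz, ez⟩ := iha
      obtain ⟨w, hw, ew⟩ := ihb
      exact ⟨z + w, add_mem hz hw, by rw [map_add, ez, ew, XMat_add]⟩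
    | smul n a _ iha =>
      obtain ⟨z, hz, ez⟩ := iha
      refine ⟨n * z, mul_mem (intCast_mem _ n) hz, ?_⟩
      rw [map_zsmul, ez, ← Int.cast_smul_eq_zsmul ℚ, smul_XMat]
      simp
  obtain ⟨z, hz, ez⟩ := hX
  rw [map_divPow, ez]
  rcases k with _ | _ | k
  · rw [divPow_zero]; exact one_mem _
  · rw [divPow_one]; exact XMat_mem_iff.2 hz
  · rw [divPow_eq_zero (n := 2) (by rw [pow_two, XMat_mul_XMat]) (by omega)]; exact zero_mem _

theorem binom_intCast {A : Type*} [Ring A] [Algebra ℚ A] (n : ℤ) (k : ℕ) :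
    binom (n : A) k = (Ring.choose n k : ℤ) := by
  have h : binom (n : ℚ) k = (Ring.choose n k : ℤ) := by
    rw [binom, Polynomial.coe_aeval_eq_eval, ← descPochhammer_eval_cast, Polynomial.eval_eq_smeval,
      Ring.descPochhammer_eq_factorial_smul_choose]
    have : (Nat.factorial k : ℚ) ≠ 0 := by positivity
    simp [this]
  have h2 := map_binom (Algebra.ofId ℚ A) (n : ℚ) k
  rw [h, map_intCast, map_intCast] at h2
  exact h2.symm

end Lattice

/-! ## The separation of the zero parts -/

section ZeroPart

/-- Block triangular matrices with corner entry in `ℤ + 2ℤ i`. -/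
def cornerRing : Subring (Matrix (Fin 3) (Fin 3) ℂ) where
  carrier := {M | M 1 0 = 0 ∧ M 2 0 = 0 ∧ M 0 0 ∈ gaussOrder}
  zero_mem' := ⟨rfl, rfl, zero_mem _⟩
  one_mem' := ⟨by simp, by simp, by simp [one_mem]⟩
  add_mem' := fun hM hN => ⟨by simp [hM.1, hN.1], by simp [hM.2.1, hN.2.1],
    add_mem hM.2.2 hN.2.2⟩
  neg_mem' := fun hM => ⟨by simp [hM.1], by simp [hM.2.1], neg_mem hM.2.2⟩
  mul_mem' := by
    intro M N hM hN
    refine ⟨?_, ?_, ?_⟩ <;> rw [Matrix.mul_apply, Fin.sum_univ_three, hN.1, hN.2.1]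
    · simp [hM.1]
    · simp [hM.2.1]
    · simpa using mul_mem hM.2.2 hN.2.2

theorem diagonal_mem_cornerRing {d : Fin 3 → ℂ} (hd : d 0 ∈ gaussOrder) :
    Matrix.diagonal d ∈ cornerRing := by
  refine ⟨?_, ?_, ?_⟩
  · exact Matrix.diagonal_apply_ne _ (by decide)
  · exact Matrix.diagonal_apply_ne _ (by decide)
  · rwa [Matrix.diagonal_apply_eq]

theorem hat_diagonal_mem {d : ℕ → Fin 3 → ℂ} {k : ℕ}
    (hd : hat (fun r => d r 0) k ∈ gaussOrder) :
    hat (fun r => Matrix.diagonal (d r)) k ∈ cornerRing := by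
  have h1 := map_hat (Matrix.diagonalAlgHom (n := Fin 3) (α := ℂ) ℚ) d k
  have h2 := map_hat (Pi.evalAlgHom ℚ (fun _ : Fin 3 => ℂ) 0) d k
  change Matrix.diagonal _ = hat (fun r => Matrix.diagonal (d r)) k at h1
  rw [← h1]
  refine diagonal_mem_cornerRing ?_
  change (hat d k) 0 = hat (fun r => d r 0) k at h2
  rwa [h2]

/-- The `t^r` are the power sums of a single variable, whose elementary symmetric functions are `1`
and `t`. -/
theorem hatSeries_pow (t : ℂ) : hatSeries (fun r => t ^ r) = 1 + C t * PowerSeries.X := by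
  refine hatSeries_eq_of_ode (fun _ _ => Commute.all _ _) (by simp) ?_
  ext n
  rw [coeff_euler, mul_add, mul_one, ← mul_assoc, map_add, map_add]
  rcases n with _ | _ | n
  · simp [coeff_newtonSeries_zero]
  · rw [coeff_succ_mul_X, coeff_succ_mul_X, coeff_mul_C, coeff_newtonSeries_zero,
      coeff_newtonSeries _ (Nat.succ_ne_zero 0), coeff_one, coeff_C]
    simp
  · rw [coeff_succ_mul_X, coeff_succ_mul_X, coeff_mul_C,
      coeff_newtonSeries _ (Nat.succ_ne_zero _), coeff_newtonSeries _ (Nat.succ_ne_zero _),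
      coeff_one, coeff_C]
    simp [pow_succ]

/-- For `E = 1 + tu` with `t² = -1`, the square is `1 + 2tu - u²` and the fourfold norm is `(1 +
u²)(1 - u²)`. Both have coefficients in `ℤ + 2ℤi`, although `t` is not there. -/
theorem hat_eps_pow_mem {t : ℂ} (ht : t = Complex.I ∨ t = -Complex.I) (k : ℕ) :
    hat (fun r => epsSign r • (2 : ℚ) • t ^ r) k ∈ gaussOrder := by
  have ht2 : t * t = -1 := by rcases ht with rfl | rfl <;> simp
  have hC : (C t : PowerSeries ℂ) * C t = -1 := by rw [← map_mul, ht2]; simp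
  have h2t : 2 * t ∈ gaussOrder := by
    rcases ht with rfl | rfl
    · exact ⟨0, 1, by simp⟩
    · exact ⟨0, -1, by simp⟩
  have hX2 : ∀ n, coeff n ((PowerSeries.X : PowerSeries ℂ) ^ 2) ∈ gaussOrder := fun n => by
    rw [coeff_X_pow]; split_ifs
    exacts [one_mem _, zero_mem _]
  have h1 : ∀ n, coeff n (1 : PowerSeries ℂ) ∈ gaussOrder := fun n => by
    rw [coeff_one]; split_ifs
    exacts [one_mem _, zero_mem _]
  have hplus : ∀ n, coeff n (1 + (PowerSeries.X : PowerSeries ℂ) ^ 2) ∈ gaussOrder := fun n => by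
    rw [map_add]; exact add_mem (h1 n) (hX2 n)
  have hE : evenNorm (hatSeries fun r => t ^ r) = 1 + PowerSeries.X ^ 2 := by
    have hr : rescale (-1) (1 + C t * PowerSeries.X) = 1 - C t * PowerSeries.X := by
      ext n
      rw [coeff_rescale]
      rcases n with _ | _ | n <;> simp [coeff_succ_mul_X, coeff_one, coeff_C]
    rw [evenNorm, hatSeries_pow, hr]
    linear_combination (-PowerSeries.X ^ 2) * hC
  refine hat_eps_mem_of_fourNorm gaussOrder (fun r => t ^ r) (fun n => ?_) (fun n => ?_) k
  · have : (1 + C t * PowerSeries.X) ^ 2 = 1 + C (2 * t) * PowerSeries.X - PowerSeries.X ^ 2 := by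
      rw [map_mul, map_ofNat]
      linear_combination (PowerSeries.X ^ 2) * hC
    rw [hatSeries_pow, this, map_sub, map_add]
    refine sub_mem (add_mem (h1 n) ?_) (hX2 n)
    rw [coeff_C_mul, coeff_X]
    split_ifs
    · simpa using h2t
    · simp [zero_mem]
  · rw [fourNorm, hE]
    refine coeff_mul_mem gaussOrder hplus (fun n => ?_) n
    rw [twistSeries, coeff_mk]
    exact mul_mem (pow_mem (neg_mem (one_mem _)) _) (hplus n)

theorem natRep_mem_of_mem_drinfeldIm {ε : ℤˣ} {b : Env} (hb : b ∈ drinfeldIm ε) :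
    natRep b ∈ cornerRing := by
  refine adjoin_le_comap natRep cornerRing ?_ hb
  rintro _ ⟨k, -, rfl⟩
  rw [map_hat]
  have hfun : ∀ r : ℕ, natRep (epsSign r • h ((ε : ℤ) * (r : ℤ))) =
      Matrix.diagonal (epsSign r • ![Complex.I ^ ((ε : ℤ) * (r : ℤ)) * 2,
        Complex.I ^ ((ε : ℤ) * (r : ℤ)) * (2 * (-1) ^ ((ε : ℤ) * (r : ℤ)) - 2),
        Complex.I ^ ((ε : ℤ) * (r : ℤ)) * (-2 * (-1) ^ ((ε : ℤ) * (r : ℤ)))]) := by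
    intro r
    rw [map_smul, natRep_h, hMat, ← Matrix.diagonal_smul]
  simp only [hfun]
  refine hat_diagonal_mem ?_
  have ht : Complex.I ^ (ε : ℤ) = Complex.I ∨ Complex.I ^ (ε : ℤ) = -Complex.I := by
    rcases Int.units_eq_one_or ε with rfl | rfl <;> simp
  have := hat_eps_pow_mem ht k
  convert this using 2
  ext r
  rw [zpow_mul, zpow_natCast]
  simp [Rat.smul_def, mul_comm]

theorem natRep_mem_of_mem_drinfeldCartan {b : Env} (hb : b ∈ drinfeldCartan) :
    natRep b ∈ cornerRing := by
  refine adjoin_le_comap natRep cornerRing ?_ hb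
  rintro _ ⟨a, ha, k, rfl⟩
  have hd : ∃ (d : Fin 3 → ℂ) (n : ℤ), d 0 = n ∧ natRep a = Matrix.diagonal d := by
    induction ha using Submodule.span_induction with
    | mem a ha =>
      obtain ⟨i, rfl⟩ := ha
      fin_cases i
      · exact ⟨_, 2, by simp, natRep_h 0⟩
      · exact ⟨0, 0, by simp, natRep_c.trans Matrix.diagonal_zero.symm⟩
    | zero => exact ⟨0, 0, by simp, (map_zero _).trans Matrix.diagonal_zero.symm⟩
    | add a b _ _ iha ihb =>
      obtain ⟨d, n, hn, ed⟩ := iha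
      obtain ⟨d', n', hn', ed'⟩ := ihb
      exact ⟨d + d', n + n', by simp [hn, hn'], by rw [map_add, ed, ed', Matrix.diagonal_add]; rfl⟩
    | smul m a _ iha =>
      obtain ⟨d, n, hn, ed⟩ := iha
      exact ⟨m • d, m * n, by simp [hn], by rw [map_zsmul, ed, Matrix.diagonal_smul]⟩
  obtain ⟨d, n, hn, ed⟩ := hd
  have h1 := map_binom (Matrix.diagonalAlgHom (n := Fin 3) (α := ℂ) ℚ) d k
  have h2 := map_binom (Pi.evalAlgHom ℚ (fun _ : Fin 3 => ℂ) 0) d k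
  change Matrix.diagonal _ = binom (Matrix.diagonal d) k at h1
  change (binom d k) 0 = binom (d 0) k at h2
  rw [map_binom, ed, ← h1]
  refine diagonal_mem_cornerRing ?_
  rw [h2, hn, binom_intCast]
  exact intCast_mem _ _

/-- The first diagonal entry of `𝔥_r` is `i^r`, so `𝔥_{±1}` gives `±i`, while all three factors of
the Drinfeld zero part keep that entry in `ℤ + 2ℤi`. -/
theorem hh_not_mem_drinfeldZero (ε : ℤˣ) : hh (ε : ℤ) ∉ drinfeldZero := by
  intro hb
  have hle : drinfeldZero ≤ subalgebraOfSubring (cornerRing.comap (natRep : Env →+* _)) :=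
    sup_le (sup_le (fun _ => natRep_mem_of_mem_drinfeldIm)
      (fun _ => natRep_mem_of_mem_drinfeldCartan)) (fun _ => natRep_mem_of_mem_drinfeldIm)
  have h1 : natRep (hh (ε : ℤ)) ∈ cornerRing := hle hb
  have h2 := h1.2.2
  rw [hh, map_smul, natRep_h, Matrix.smul_apply, hMat, Matrix.diagonal_apply_eq] at h2
  have h3 : (1 / 2 : ℚ) • (Complex.I ^ (ε : ℤ) * 2) = Complex.I ^ (ε : ℤ) := by
    rw [Rat.smul_def]; push_cast; ring
  simp only [Matrix.cons_val_zero, h3] at h2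
  have h4 : Complex.I ∈ gaussOrder := by
    rcases Int.units_eq_one_or ε with rfl | rfl
    · simpa using h2
    · simpa using h2
  rw [mem_gaussOrder, I_mem_gaussGroup_iff] at h4
  exact absurd h4 (by decide)

theorem hh_mem_mitzmanIm (ε : ℤˣ) : hh (ε : ℤ) ∈ mitzmanIm ε := by
  have h1 : hat (fun r : ℕ => hh ((ε : ℤ) * (r : ℤ))) 1 = hh (ε : ℤ) := by
    have := congrArg (coeff 1) (euler_hatSeries (commute_hh_unit ε))
    rw [coeff_euler, one_smul, coeff_hatSeries, coeff_mul, Finset.Nat.antidiagonal_succ] at this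
    have h0 := coeff_zero_hatSeries fun r : ℕ => hh ((ε : ℤ) * (r : ℤ))
    rw [coeff_hatSeries] at h0
    simpa [coeff_newtonSeries_zero, coeff_newtonSeries, coeff_hatSeries, h0] using this
  rw [← h1]
  exact hat_mem_zSym _ 1

end ZeroPart

/-! ## A level zero representation with an odd weight -/

section OddWeight

section Weyl

variable {A : Type*} [Ring A] [Algebra ℂ A]

/-- The map `E_{ij} ↦ X_i D_j`. -/
def weylMap (X D : Fin 3 → A) : Matrix (Fin 3) (Fin 3) ℂ →+ A where
  toFun M := ∑ i, ∑ j, M i j • (X i * D j)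
  map_zero' := by simp
  map_add' M N := by simp [add_smul, sum_add_distrib]

theorem weylMap_apply (X D : Fin 3 → A) (M : Matrix (Fin 3) (Fin 3) ℂ) :
    weylMap X D M = ∑ i, ∑ j, M i j • (X i * D j) := rfl

/-- Normal ordering: moving `D j` past `X k` leaves a quadratic term plus the contraction, which is
the matrix product. -/
theorem weylMap_mul {X D : Fin 3 → A}
    (hDX : ∀ j i, D j * X i = X i * D j + if i = j then 1 else 0)
    (M N : Matrix (Fin 3) (Fin 3) ℂ) :
    weylMap X D M * weylMap X D N =
      (∑ i, ∑ j, ∑ k, ∑ l, (M i j * N k l) • (X i * X k * (D j * D l))) +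
        weylMap X D (M * N) := by
  have h : weylMap X D (M * N) =
      ∑ i, ∑ j, ∑ k, ∑ l, (M i j * N k l) • (if k = j then X i * D l else 0) := by
    rw [weylMap_apply]
    refine sum_congr rfl fun i _ => ?_
    simp only [Matrix.mul_apply, sum_smul, smul_ite, smul_zero]
    rw [sum_comm]
    refine sum_congr rfl fun j _ => ?_
    rw [sum_comm]
    simp
  rw [h]
  simp only [weylMap_apply, sum_mul]
  simp only [mul_sum, ← sum_add_distrib]
  refine sum_congr rfl fun i _ => sum_congr rfl fun j _ => sum_congr rfl fun k _ =>
    sum_congr rfl fun l _ => ?_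
  rw [smul_mul_smul_comm, ← smul_add]
  congr 1
  rw [mul_assoc, ← mul_assoc (D j), hDX, add_mul, mul_add, ← mul_assoc, ← mul_assoc, ← mul_assoc]
  split_ifs <;> simp [mul_assoc]

/-- The normally ordered term is symmetric in `M` and `N`, because the `X`'s commute among
themselves and so do the `D`'s. It cancels in the commutator. -/
theorem weylMap_bracket {X D : Fin 3 → A} (hX : ∀ i j, X i * X j = X j * X i)
    (hD : ∀ i j, D i * D j = D j * D i)
    (hDX : ∀ j i, D j * X i = X i * D j + if i = j then 1 else 0)
    (M N : Matrix (Fin 3) (Fin 3) ℂ) : weylMap X D (M * N - N * M) =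
      weylMap X D M * weylMap X D N - weylMap X D N * weylMap X D M := by
  have hsym : (∑ i, ∑ j, ∑ k, ∑ l, (M i j * N k l) • (X i * X k * (D j * D l))) =
      ∑ i, ∑ j, ∑ k, ∑ l, (N i j * M k l) • (X i * X k * (D j * D l)) := by
    calc _ = ∑ i, ∑ k, ∑ j, ∑ l, (M i j * N k l) • (X i * X k * (D j * D l)) :=
          sum_congr rfl fun i _ => sum_comm
      _ = ∑ k, ∑ i, ∑ l, ∑ j, (M i j * N k l) • (X i * X k * (D j * D l)) := by
          rw [sum_comm]
          exact sum_congr rfl fun k _ => sum_congr rfl fun i _ => sum_comm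
      _ = ∑ k, ∑ l, ∑ i, ∑ j, (M i j * N k l) • (X i * X k * (D j * D l)) :=
          sum_congr rfl fun i _ => sum_comm
      _ = _ := by
          refine sum_congr rfl fun k _ => sum_congr rfl fun l _ => sum_congr rfl fun i _ =>
            sum_congr rfl fun j _ => ?_
          rw [mul_comm (M i j), hX i k, hD j l]
  rw [map_sub, weylMap_mul hDX, weylMap_mul hDX, hsym]
  abel

end Weyl

/-- Families of coefficients of the monomials `x^(n + (1/2, 0, 0))`. -/
abbrev Coeffs := (Fin 3 → ℤ) → ℂ

/-- Multiplication by the coordinate `x_i`. -/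
def mulOp (i : Fin 3) : Module.End ℂ Coeffs where
  toFun f n := f (n - Pi.single i 1)
  map_add' _ _ := rfl
  map_smul' _ _ := rfl

/-- The derivative `∂/∂x_j`. -/
def derOp (j : Fin 3) : Module.End ℂ Coeffs where
  -- The monomial indexed by `n + e_j` has exponent `n_j + 1` in direction `j`, increased by `1/2`
  -- in direction `0`; that exponent is the factor.
  toFun f n := ((n j : ℂ) + 1 + if j = 0 then 1 / 2 else 0) * f (n + Pi.single j 1)
  map_add' f g := by ext n; simp [mul_add]
  map_smul' a f := by ext n; simp; ring

theorem mulOp_apply (i : Fin 3) (f : Coeffs) (n : Fin 3 → ℤ) :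
    mulOp i f n = f (n - Pi.single i 1) := rfl

theorem derOp_apply (j : Fin 3) (f : Coeffs) (n : Fin 3 → ℤ) : derOp j f n =
    ((n j : ℂ) + 1 + if j = 0 then 1 / 2 else 0) * f (n + Pi.single j 1) := rfl

theorem mulOp_comm (i j : Fin 3) : mulOp i * mulOp j = mulOp j * mulOp i := by
  ext f n
  simp only [Module.End.mul_apply, mulOp_apply]
  rw [sub_right_comm]

theorem derOp_comm (i j : Fin 3) : derOp i * derOp j = derOp j * derOp i := by
  ext f n
  rcases eq_or_ne i j with rfl | h
  · rfl
  simp only [Module.End.mul_apply, derOp_apply, Pi.add_apply, Pi.single_eq_of_ne h,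
    Pi.single_eq_of_ne h.symm]
  rw [add_right_comm n]
  push_cast
  ring

theorem derOp_mulOp (j i : Fin 3) :
    derOp j * mulOp i = mulOp i * derOp j + if i = j then 1 else 0 := by
  ext f n
  rcases eq_or_ne i j with rfl | h
  · simp only [Module.End.mul_apply, LinearMap.add_apply, derOp_apply, mulOp_apply, if_true,
      Pi.add_apply, Module.End.one_apply, Pi.sub_apply, Pi.single_eq_same, add_sub_cancel_right,
      sub_add_cancel]
    push_cast
    ring
  · simp only [Module.End.mul_apply, LinearMap.add_apply, derOp_apply, mulOp_apply, if_neg h,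
      Pi.add_apply, LinearMap.zero_apply, Pi.zero_apply, Pi.sub_apply, Pi.single_eq_of_ne h.symm]
    rw [sub_add_eq_add_sub]
    simp

/-- The level zero representation of `Ũ` on `Coeffs`. -/
def oddRep : Env →ₐ[ℚ] Module.End ℂ Coeffs :=
  rep (weylMap mulOp derOp) (weylMap_bracket mulOp_comm derOp_comm derOp_mulOp)

/-- The coefficient family of `x^(1/2, 0, 0)`. -/
def oddVec : Coeffs := Pi.single 0 1

theorem oddRep_c : oddRep c = 0 := by
  have : oddRep c = weylMap mulOp derOp 0 := rep_proj _ _ Gen.c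
  rw [this, map_zero]

theorem mulOp_derOp_oddVec (i : Fin 3) :
    (mulOp i * derOp i) oddVec = (if i = 0 then (1 / 2 : ℂ) else 0) • oddVec := by
  ext n
  rw [Module.End.mul_apply, mulOp_apply, derOp_apply, sub_add_cancel, Pi.smul_apply, oddVec,
    smul_eq_mul]
  rcases eq_or_ne n 0 with rfl | h
  · simp
  · rw [Pi.single_eq_of_ne h]; simp

theorem oddRep_h_zero : oddRep (h 0) oddVec = oddVec := by
  have h1 : oddRep (h 0) = weylMap mulOp derOp (hMat (Complex.I ^ (0 : ℤ)) ((-1) ^ (0 : ℤ))) :=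
    rep_proj _ _ (Gen.h 0)
  have h2 : weylMap mulOp derOp (hMat (Complex.I ^ (0 : ℤ)) ((-1) ^ (0 : ℤ))) =
      (2 : ℂ) • (mulOp 0 * derOp 0) + (-2 : ℂ) • (mulOp 2 * derOp 2) := by
    simp [weylMap_apply, Fin.sum_univ_three, hMat, Matrix.diagonal_apply]
    module
  rw [h1, h2, LinearMap.add_apply, LinearMap.smul_apply, LinearMap.smul_apply, mulOp_derOp_oddVec,
    mulOp_derOp_oddVec]
  simp

/-- Operators having `oddVec` as an eigenvector with integral eigenvalue. -/
def integralRing : Subring (Module.End ℂ Coeffs) where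
  carrier := {T | ∃ m : ℤ, T oddVec = (m : ℂ) • oddVec}
  zero_mem' := ⟨0, by simp⟩
  one_mem' := ⟨1, by simp⟩
  add_mem' := by
    rintro S T ⟨m, hm⟩ ⟨n, hn⟩
    exact ⟨m + n, by rw [LinearMap.add_apply, hm, hn, ← add_smul]; push_cast; rfl⟩
  neg_mem' := by
    rintro S ⟨m, hm⟩
    exact ⟨-m, by rw [LinearMap.neg_apply, hm, ← neg_smul]; push_cast; rfl⟩
  mul_mem' := by
    rintro S T ⟨m, hm⟩ ⟨n, hn⟩
    exact ⟨m * n, by rw [Module.End.mul_apply, hn, map_smul, hm, smul_smul]; push_cast; ring_nf⟩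

/-- A polynomial in `T` acts on an eigenvector through its value at the eigenvalue, and binomials of
integers are integers. -/
theorem binom_apply_eigenvector {T : Module.End ℂ Coeffs} {m : ℤ} {v : Coeffs}
    (hT : T v = (m : ℂ) • v) (k : ℕ) : binom T k v = ((Ring.choose m k : ℤ) : ℂ) • v := by
  rw [← binom_intCast]
  induction k with
  | zero => simp
  | succ k ih =>
    have h1 := congrArg (fun S : Module.End ℂ Coeffs => S v) (nsmul_binom_succ T k)
    have h2 := nsmul_binom_succ (m : ℂ) k
    -- `T` is moved to the right of the binomial, so that it meets the eigenvector first.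
    rw [← (commute_binom (Commute.refl T) k).eq.symm] at h1
    simp only [LinearMap.smul_apply, LinearMap.sub_apply, Module.End.mul_apply, hT, map_smul,
      ih] at h1
    have hk : ((k : ℂ) + 1) ≠ 0 := by exact_mod_cast Nat.succ_ne_zero k
    refine smul_right_injective Coeffs hk ?_
    simp only [← Nat.cast_smul_eq_nsmul ℂ, smul_smul] at h1 h2 ⊢
    push_cast at h1 h2
    rw [h1, ← smul_eq_mul ((k : ℂ) + 1), h2, sub_smul]
    rfl

/-- On `oddVec`, `h_0` acts by `1` and `c` by `0`, so every binomial in their span acts by an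
integer, whereas `c̃ - 𝔥_0` acts by `-1/2`. -/
theorem not_mem_zBin : cc - hh 0 ∉ zBin ![(2 : ℚ) • hh 0, (4 : ℚ) • cc] := by
  rw [← zBin_h_c_eq]
  intro hb
  have h1 : oddRep (cc - hh 0) ∈ integralRing := by
    refine adjoin_le_comap oddRep integralRing ?_ hb
    rintro _ ⟨a, ha, k, rfl⟩
    have hm : oddRep a ∈ integralRing := by
      have := adjoin_le_comap oddRep integralRing (s := Set.range ![h 0, c]) ?_
        (Algebra.span_le_adjoin ℤ _ ha)
      · exact this
      · rintro _ ⟨i, rfl⟩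
        fin_cases i
        · exact ⟨1, by simpa using oddRep_h_zero⟩
        · exact ⟨0, by simp [oddRep_c]⟩
    obtain ⟨m, hm⟩ := hm
    rw [map_binom]
    exact ⟨_, binom_apply_eigenvector hm k⟩
  obtain ⟨m, hm⟩ := h1
  have h2 : oddRep (cc - hh 0) oddVec = (-1 / 2 : ℂ) • oddVec := by
    rw [map_sub, cc, hh, map_smul, map_smul, oddRep_c, smul_zero, zero_sub, LinearMap.neg_apply,
      LinearMap.smul_apply, oddRep_h_zero]
    ext n
    simp [Rat.smul_def]
    ring
  rw [h2] at hm
  have h3 := congrFun hm 0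
  simp only [Pi.smul_apply, oddVec, Pi.single_eq_same, smul_eq_mul, mul_one] at h3
  have h4 : (-1 : ℂ) = ((2 * m : ℤ) : ℂ) := by push_cast; linear_combination 2 * h3
  have h5 : (-1 : ℤ) = 2 * m := by exact_mod_cast h4
  omega

end OddWeight

/-! ### The strict inclusions -/

theorem y_not_mem_drinfeldForm (ε : ℤˣ) : y ε 0 ∉ drinfeldForm :=
  fun hb => natRep_y_zero_not_mem ε (natRep_mem_of_mem_drinfeldForm hb)

theorem zDiv_X_lt (ε : ℤˣ) : zDiv (fun r : ℤ => X ε r) < zDiv (fun r : ℤ => y ε r) := by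
  refine lt_of_le_of_ne ?_ fun heq => ?_
  · have hspan : Submodule.span ℤ (Set.range fun r : ℤ => X ε r) ≤
        Submodule.span ℤ (Set.range fun r : ℤ => y ε r) := Submodule.span_le.2 <| by
      rintro _ ⟨r, rfl⟩
      exact X_mem_span_y ε r
    refine Algebra.adjoin_mono ?_
    rintro _ ⟨a, ha, k, rfl⟩
    exact ⟨a, hspan ha, k, rfl⟩
  · refine natRep_y_zero_not_mem ε (natRep_mem_of_mem_zDiv (ε := ε) ?_)
    rw [heq, ← divPow_one (y ε 0)]
    exact divPow_mem_zDiv _ (Submodule.subset_span ⟨0, rfl⟩) 1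

theorem drinfeldReal_lt (ε : ℤˣ) : (drinfeldReal ε).toSubmodule < mitzmanReal ε := by
  refine lt_of_le_of_ne (drinfeldReal_le_mitzmanReal ε) fun heq => ?_
  have hle : drinfeldReal ε ≤ drinfeldForm := by
    refine Algebra.adjoin_mono ?_
    rintro _ ⟨r, k, rfl⟩
    exact ⟨ε, r, k, rfl⟩
  have hy : y ε 0 ∈ zDiv fun r : ℤ => y ε r := by
    rw [← divPow_one (y ε 0)]
    exact divPow_mem_zDiv _ (Submodule.subset_span ⟨0, rfl⟩) 1
  have hmem := Submodule.mul_mem_mul (Submodule.mul_mem_mul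
    (M := (zDiv fun r : ℤ => x ε (2 * r)).toSubmodule) (N := (zDiv fun r : ℤ => y ε r).toSubmodule)
    (one_mem (zDiv fun r : ℤ => x ε (2 * r))) hy)
    (N := (zDiv fun r : ℤ => x ε (2 * r + 1)).toSubmodule)
    (one_mem (zDiv fun r : ℤ => x ε (2 * r + 1)))
  rw [one_mul, mul_one] at hmem
  have hmem' : y ε 0 ∈ mitzmanReal ε := hmem
  rw [← heq] at hmem'
  exact y_not_mem_drinfeldForm ε (hle hmem')

theorem zSym_eps_lt (ε : ℤˣ) : zSym (fun r : ℕ => epsSign r • h ((ε : ℤ) * (r : ℤ))) <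
    zSym (fun r : ℕ => hh ((ε : ℤ) * (r : ℤ))) := by
  refine lt_of_le_of_ne (drinfeldIm_le_mitzmanIm ε) fun heq => hh_not_mem_drinfeldZero ε ?_
  have h1 : hh (ε : ℤ) ∈ drinfeldIm ε := by
    rw [drinfeldIm, heq]; exact hh_mem_mitzmanIm ε
  have h2 : drinfeldIm ε ≤ drinfeldZero := by
    rcases Int.units_eq_one_or ε with rfl | rfl
    · exact le_sup_right
    · exact le_sup_left.trans le_sup_left
  exact h2 h1

theorem drinfeldZero_lt : drinfeldZero.toSubmodule < mitzmanZero := by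
  refine lt_of_le_of_ne drinfeldZero_le_mitzmanZero fun heq => hh_not_mem_drinfeldZero 1 ?_
  have hmem := Submodule.mul_mem_mul (N := (mitzmanIm 1).toSubmodule)
    (Submodule.mul_mem_mul (M := (mitzmanIm (-1)).toSubmodule) (N := mitzmanCartan.toSubmodule)
      (one_mem (mitzmanIm (-1))) (one_mem mitzmanCartan)) (hh_mem_mitzmanIm 1)
  rw [one_mul, one_mul] at hmem
  have hmem' : hh ((1 : ℤˣ) : ℤ) ∈ mitzmanZero := hmem
  rw [← heq] at hmem'
  exact hmem'

theorem drinfeldForm_lt : drinfeldForm < mitzmanForm := by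
  refine lt_of_le_of_ne drinfeldForm_le_mitzmanForm fun heq => y_not_mem_drinfeldForm 1 ?_
  rw [heq, ← divPow_one (y 1 0)]
  exact divPow_y_mem_mitzmanForm 1 (Or.inl rfl) 1

theorem zBin_lt : zBin ![(2 : ℚ) • hh 0, (4 : ℚ) • cc] < zBin ![(2 : ℚ) • hh 0, cc - hh 0] := by
  refine lt_of_le_of_ne zBin_le fun heq => not_mem_zBin ?_
  have h := binom_mem_zBin ![(2 : ℚ) • hh 0, cc - hh 0] (Submodule.subset_span ⟨1, rfl⟩) 1
  rw [binom_one] at h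
  rw [heq]
  exact h

end A22

end

theorem mainTheorem3 :
    A22.drinfeldForm < A22.mitzmanForm ∧
    (∀ ε : ℤˣ,
      A22.zDiv (fun r : ℤ => A22.X ε r) < A22.zDiv (fun r : ℤ => A22.y ε r) ∧
      (A22.drinfeldReal ε).toSubmodule < A22.mitzmanReal ε) ∧
    A22.zBin ![A22.h 0, A22.c] = A22.zBin ![(2 : ℚ) • A22.hh 0, (4 : ℚ) • A22.cc] ∧
    A22.zBin ![(2 : ℚ) • A22.hh 0, (4 : ℚ) • A22.cc] <
      A22.zBin ![(2 : ℚ) • A22.hh 0, A22.cc - A22.hh 0] ∧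
    (∀ ε : ℤˣ,
      A22.zSym (fun r : ℕ => A22.epsSign r • A22.h ((ε : ℤ) * (r : ℤ))) <
        A22.zSym (fun r : ℕ => A22.hh ((ε : ℤ) * (r : ℤ)))) ∧
    A22.drinfeldZero.toSubmodule < A22.mitzmanZero :=
  ⟨A22.drinfeldForm_lt, fun ε => ⟨A22.zDiv_X_lt ε, A22.drinfeldReal_lt ε⟩, A22.zBin_h_c_eq,
    A22.zBin_lt, A22.zSym_eps_lt, A22.drinfeldZero_lt⟩
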